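/- A one-counter automaton is a nondeterministic pushdown automaton ($\varepsilon$-moves allowed, acceptance by final state) with a single stack letter, which is able to check the emptiness of its stack. The languages $L\subseteq\Sigma^*$ (with $\Sigma$ a finite alphabet) that such automata accept are called counter languages. For $P\subseteq\Sigma^*$ let $C_P=\{ww \mid w\in P\}$; thus $C_{\Sigma^*}$ is the set of all squares over $\Sigma$. (1) It is undecidable for counter languages $L\subseteq\Sigma^*$ whether $C_{\Sigma^*}\subseteq L$: no algorithm decides this when it is given the size of $\Sigma$ and a one-counter automaton that accepts $L$. Moreover, there is a fixed finite alphabet $\Sigma$ over which the problem is already undecidable. (2) Let $g,h\colon\Sigma^*\to\Delta^*$ be morphisms, where $\Sigma,\Delta$ are finite alphabets (an instance of the Post correspondence problem), let $\#\notin\Sigma$ and $\Gamma=\Sigma\cup\{\#\}$. Let $L(g,h)\subseteq\Gamma^*$ consist of all words that are not of the form $u\#v\#$ with $u,v\in\Sigma^*$, and of all words $u\#v\#$ with $u,v\in\Sigma^*$ such that $u\neq v$ or $g(u)\neq h(v)$. Then $L(g,h)$ is a counter language, and it contains every square of $\Gamma^*$ except precisely the words $u\#u\#$ with $u\in\Sigma^*$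 and $g(u)=h(u)$. Moreover, $L(g,h)\cup\{\#\#\}$ is a counter language, and $C_{\Gamma^*}\subseteq L(g,h)\cup\{\#\#\}$ holds if and only if the instance has no nonempty solution, i.e. there is no nonempty $u\in\Sigma^*$ with $g(u)=h(u)$. -/

import Mathlib

/-- A nondeterministic one-counter automaton with input alphabet `α` and state set `Q`: a
pushdown automaton with a single stack letter `c` that can check the emptiness of its stack.

A transition is a tuple `(p, a, z, m, q)`: in state `p` it reads the letter `x` if `a = some x`,
and nothing if `a = none` (an `ε`-move), and goes to state `q`.
If `z = true`, it applies only when the stack is empty, and it pushes `c ^ m`.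
If `z = false`, it applies only when the stack is nonempty; it pops the topmost `c` and then
pushes `c ^ m`. -/
structure OneCounterAutomaton (α Q : Type*) where
  /-- The initial state. -/
  start : Q
  /-- The accepting states. -/
  accept : Set Q
  /-- The transition relation. -/
  trans : Set (Q × Option α × Bool × ℕ × Q)
  /-- There are finitely many transitions. -/
  finite_trans : trans.Finite

namespace OneCounterAutomaton

variable {α Q : Type*}

/-- `M.Run p n w q m`: the automaton can pass from state `p` with stack `c ^ n` to state `q` with
stack `c ^ m` while reading exactly the word `w`. -/
inductive Run (M : OneCounterAutomaton α Q) : Q → ℕ → List α → Q → ℕ → Prop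
  | refl (p : Q) (n : ℕ) : Run M p n [] p n
  | stepEmpty {p q r : Q} {a : Option α} {m k : ℕ} {w : List α}
      (ht : (p, a, true, m, q) ∈ M.trans) (hr : Run M q m w r k) :
      Run M p 0 (a.toList ++ w) r k
  | stepNonempty {p q r : Q} {a : Option α} {n m k : ℕ} {w : List α}
      (ht : (p, a, false, m, q) ∈ M.trans) (hr : Run M q (n + m) w r k) :
      Run M p (n + 1) (a.toList ++ w) r k

/-- The language accepted by a one-counter automaton, by final state, starting with the empty
stack. -/
def language (M : OneCounterAutomaton α Q) : Language α :=
  {w | ∃ q ∈ M.accept, ∃ n : ℕ, M.Run M.start 0 w q n}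

end OneCounterAutomaton

/-- A language is a counter language if it is accepted by a one-counter automaton with finitely
many states. -/
def IsCounterLanguage {α : Type*} (L : Language α) : Prop :=
  ∃ (Q : Type) (_ : Finite Q) (M : OneCounterAutomaton α Q), M.language = L

/-- The finite descriptions of one-counter automata, used as inputs of algorithms:
`(s, F, T)` describes an automaton with the states `0, …, s`, initial state `0`, accepting
states listed in `F` and transitions listed in `T`. Input letters are numbered from `0`. -/
abbrev CounterCode : Type :=
  ℕ × List ℕ × List (ℕ × Option ℕ × Bool × ℕ × ℕ)

/-- The transition, with states and letters replaced by their numbers. -/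
def transNumbers {k s : ℕ} (t : Fin s × Option (Fin k) × Bool × ℕ × Fin s) :
    ℕ × Option ℕ × Bool × ℕ × ℕ :=
  (t.1.val, t.2.1.map Fin.val, t.2.2.1, t.2.2.2.1, t.2.2.2.2.val)

theorem transNumbers_injective {k s : ℕ} : Function.Injective (transNumbers (k := k) (s := s)) := by
  rintro ⟨p, a, z, m, q⟩ ⟨p', a', z', m', q'⟩ h
  simp only [transNumbers, Prod.mk.injEq] at h
  obtain ⟨h1, h2, h3, h4, h5⟩ := h
  have h2' := Option.map_injective Fin.val_injective h2
  simp [Fin.ext h1, h2', h3, h4, Fin.ext h5]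

/-- The one-counter automaton over the alphabet `{0, …, k - 1}` that is described by a code. Entries
of the lists that mention a state or a letter outside of the range have no effect. -/
def CounterCode.toAutomaton (k : ℕ) (c : CounterCode) :
    OneCounterAutomaton (Fin k) (Fin (c.1 + 1)) where
  start := 0
  accept := {q | q.val ∈ c.2.1}
  trans := {t | transNumbers t ∈ c.2.2}
  finite_trans := (List.finite_toSet c.2.2).preimage transNumbers_injective.injOn

/-- Runs are preserved by maps of states that preserve transitions. -/
theorem OneCounterAutomaton.Run.mapStates {α Q Q' : Type*} (M : OneCounterAutomaton α Q) (M' : OneCounterAutomaton α Q')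
  (e : Q → Q') (he : ∀ p a z m q, (p,a,z,m,q) ∈ M.trans → (e p,a,z,m,e q) ∈ M'.trans)
  {p n w q m} (h : M.Run p n w q m) : M'.Run (e p) n w (e q) m := by
  induction h with
  | refl => exact .refl _ _
  | stepEmpty ht _ ih => exact .stepEmpty (he _ _ _ _ _ ht) ih
  | stepNonempty ht _ ih => exact .stepNonempty (he _ _ _ _ _ ht) ih

/-- The codes describe exactly the counter languages over the alphabet `{0, …, k - 1}`. -/
theorem isCounterLanguage_iff_exists_code {k : ℕ} (L : Language (Fin k)) :
  IsCounterLanguage L ↔ ∃ c : CounterCode, (c.toAutomaton k).language = L := by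
  constructor
  · rintro ⟨Q, _, M, rfl⟩
    obtain ⟨n, ⟨e0⟩⟩ := Finite.exists_equiv_fin Q
    obtain ⟨s, rfl⟩ : ∃ s, n = s+1 := by
      cases n with
      | zero => exact (e0 M.start).elim0
      | succ s => exact ⟨s, rfl⟩
    let e : Q ≃ Fin (s+1) := e0.trans (Equiv.swap (e0 M.start) 0)
    have hes : e M.start = 0 := by simp [e]
    have hf : (M.accept).Finite := Set.toFinite _
    let F := hf.toFinset.toList.map (fun q => (e q).val)
    let T := M.finite_trans.toFinset.toList.map (fun t => transNumbers (e t.1, t.2.1, t.2.2.1, t.2.2.2.1, e t.2.2.2.2))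
    have hT : ∀ p a z m q, (p,a,z,m,q) ∈ M.trans ↔ (e p,a,z,m,e q) ∈ (CounterCode.toAutomaton k (s,F,T)).trans := by
      intro p a z m q
      simp only [CounterCode.toAutomaton, T, Set.mem_ofPred_eq, List.mem_map, Finset.mem_toList, Set.Finite.mem_toFinset]
      constructor
      · intro h; exact ⟨_, h, rfl⟩
      · rintro ⟨⟨p',a',z',m',q'⟩, h, h2⟩
        have := transNumbers_injective h2
        simp at this
        obtain ⟨rfl, rfl, rfl, rfl, rfl⟩ := this
        exact h
    have hF : ∀ q, q ∈ M.accept ↔ e q ∈ (CounterCode.toAutomaton k (s,F,T)).accept := by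
      intro q
      simp [CounterCode.toAutomaton, F, ← Fin.ext_iff]
    refine ⟨(s,F,T), ?_⟩
    ext w
    constructor
    · rintro ⟨q, hq, n, hr⟩
      refine ⟨e.symm q, (hF _).2 (by simpa using hq), n, ?_⟩
      have := OneCounterAutomaton.Run.mapStates _ M e.symm (fun p a z m q h => (hT _ _ _ _ _).2 (by simpa using h)) hr
      rwa [show e.symm (CounterCode.toAutomaton k (s,F,T)).start = M.start by
        rw [Equiv.symm_apply_eq]; exact hes.symm] at this
    · rintro ⟨q, hq, n, hr⟩
      refine ⟨e q, (hF _).1 hq, n, ?_⟩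
      have := OneCounterAutomaton.Run.mapStates M (CounterCode.toAutomaton k (s,F,T)) e (fun p a z m q h => (hT _ _ _ _ _).1 h) hr
      rwa [hes] at this
  · rintro ⟨c, rfl⟩
    exact ⟨_, inferInstance, _, rfl⟩

/-- The copy language `C_P = {ww | w ∈ P}`. -/
def copyLanguage {α : Type*} (P : Language α) : Language α :=
  {x | ∃ w ∈ P, x = w ++ w}

/-- The word `u#v#` over `Γ = Σ ∪ {#}`; here `Γ` is `Option σ` and `#` is `none`. -/
def hashWord {σ : Type*} (u v : List σ) : List (Option σ) :=
  u.map some ++ [none] ++ v.map some ++ [none]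

/-- The language over `Γ = Σ ∪ {#}` built from an instance `(g, h)` of the Post correspondence
problem: all words that are not of the form `u#v#` with `u, v ∈ Σ*`, and all words `u#v#` such that
`u ≠ v` or `g(u) ≠ h(v)`. -/
def pcpLanguage {σ δ : Type*} (g h : FreeMonoid σ →* FreeMonoid δ) : Language (Option σ) :=
  {w | (∀ u v : List σ, w ≠ hashWord u v) ∨
    ∃ u v : List σ, w = hashWord u v ∧
      (u ≠ v ∨ g (FreeMonoid.ofList u) ≠ h (FreeMonoid.ofList v))}

/-! The two halves of the theorem are proved independently: undecidability is reduced from the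
halting problem, not from the Post correspondence problem.

For an instance (g, h), acceptance only ever has to certify an inequality, and one counter suffices
for that. To certify g(u) ≠ h(v), guess an index at which the images differ ("past the end" counts
as a value), load it into the counter while reading u, and count it down while reading v. The
identity in place of g and h certifies u ≠ v, and the words not of the form u#v# form a regular set
(`exists_isCounterRel_pcp`). A square of the form u#v# has u = v (`eq_of_square_eq_hashWord`), so
the only squares left out come from solutions. The empty solution always exists; adding ## discards
it.

For undecidability, a program is a regular language of sequences of increments, decrements and zero
tests on finitely many registers: products are compositions, and a Kleene star followed by a zero
test is a loop. All partial recursive functions are computed this way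
(`RegisterComputable.of_partrec`). Hence there is one regular L such that the n-th code halts on 0
if and only if some x ∈ L is applicable when every register starts with n. Registers do not
interact, so an inapplicable sequence already fails on a single register, which a one-counter
automaton can guess and simulate. Let it accept the words without #, and those whose part before the
first # is outside L or fails. If w contains #, this part is the same for w and ww, so all squares
are accepted if and only if no x ∈ L is applicable (`exists_isCounterRel_squares_iff`). Only the
initial counter value depends on n, so the alphabet is fixed and the code is computable from n. -/

namespace Language

/-! ### Closure properties of regular languages, by finiteness of left quotients. -/

variable {α β : Type*}

theorem isRegular_top : IsRegular (⊤ : Language α) := by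
  refine IsRegular.of_finite_range_leftQuotient ((Set.finite_singleton ⊤).subset ?_)
  rintro _ ⟨x, rfl⟩
  rfl

theorem IsRegular.image_some {L : Language α} (hL : L.IsRegular) :
    IsRegular {w : List (Option α) | ∃ u ∈ L, w = u.map some} := by
  let F (K : Language α) : Language (Option α) := {w | ∃ u ∈ K, w = u.map some}
  have hF : (insert (0 : Language (Option α)) (F '' Set.range L.leftQuotient)).Finite :=
    (hL.finite_range_leftQuotient.image F).insert 0
  refine IsRegular.of_finite_range_leftQuotient (hF.subset ?_)
  rintro _ ⟨x, rfl⟩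
  by_cases hx : ∃ u : List α, x = u.map some
  · right
    obtain ⟨u, rfl⟩ := hx
    refine ⟨_, ⟨u, rfl⟩, ?_⟩
    ext z
    constructor
    · rintro ⟨t, ht, rfl⟩
      exact ⟨u ++ t, ht, by simp⟩
    · rintro ⟨t, ht, h⟩
      obtain ⟨a, b, rfl, h1, h2⟩ := List.append_eq_map_iff.1 h
      obtain rfl := List.map_injective_iff.2 (Option.some_injective α) h1
      exact ⟨b, ht, h2.symm⟩
  · left
    ext z
    refine iff_of_false ?_ (Language.notMem_zero z)
    rintro ⟨t, -, h⟩
    obtain ⟨a, b, rfl, h1, h2⟩ := List.append_eq_map_iff.1 h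
    exact hx ⟨a, h1.symm⟩

theorem isRegular_map_some : IsRegular {w : List (Option α) | ∃ u : List α, w = u.map some} :=
  (congrArg IsRegular (Set.ext fun _ ↦ exists_congr fun _ ↦
    (and_iff_right trivial).symm)).mpr isRegular_top.image_some

theorem isRegular_singleton_letter (a : α) : IsRegular ({[a]} : Language α) := by
  refine IsRegular.of_finite_range_leftQuotient (Set.Finite.subset
    (Set.toFinite {({[a]} : Language α), 1, 0}) ?_)
  rintro _ ⟨x, rfl⟩
  rcases x with _ | ⟨b, _ | ⟨c, x⟩⟩
  · left; rfl
  · by_cases h : b = a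
    · right; left
      subst h
      ext z
      change [b] ++ z = [b] ↔ z ∈ (1 : Language α)
      simp [Language.mem_one]
    · right; right
      ext z
      change [b] ++ z = [a] ↔ _
      simp [h, Language.notMem_zero]
  · right; right
    ext z
    change (b :: c :: x) ++ z = [a] ↔ _
    simp [Language.notMem_zero]

theorem IsRegular.comap_map {L : Language β} (hL : L.IsRegular) (f : α → β) :
    IsRegular ({x | x.map f ∈ L} : Language α) := by
  refine IsRegular.of_finite_range_leftQuotient
    ((hL.finite_range_leftQuotient.image fun K : Language β ↦
      ({x | x.map f ∈ K} : Language α)).subset ?_)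
  rintro _ ⟨x, rfl⟩
  refine ⟨_, ⟨x.map f, rfl⟩, ?_⟩
  ext z
  change x.map f ++ z.map f ∈ L ↔ (x ++ z).map f ∈ L
  rw [List.map_append]

/-- The quotient by `x` is determined by the quotient of `L₁` by `x` and the set of quotients of
`L₂` by what remains of `x` after a prefix in `L₁`. There are finitely many such pairs. -/
theorem IsRegular.mul {L₁ L₂ : Language α} (h₁ : L₁.IsRegular) (h₂ : L₂.IsRegular) :
    (L₁ * L₂).IsRegular := by
  refine IsRegular.of_finite_range_leftQuotient
    (((h₁.finite_range_leftQuotient.prod h₂.finite_range_leftQuotient.finite_subsets).image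
      fun p : Language α × Set (Language α) ↦
        ({z | z ∈ p.1 * L₂ ∨ ∃ K ∈ p.2, z ∈ K} : Language α)).subset ?_)
  rintro _ ⟨x, rfl⟩
  refine ⟨(L₁.leftQuotient x, {K | ∃ u ∈ L₁, ∃ y, x = u ++ y ∧ K = L₂.leftQuotient y}),
    ⟨⟨x, rfl⟩, ?_⟩, ?_⟩
  · rintro _ ⟨u, -, y, -, rfl⟩
    exact ⟨y, rfl⟩
  · ext z
    change (z ∈ L₁.leftQuotient x * L₂ ∨ ∃ K, _ ∧ z ∈ K) ↔ x ++ z ∈ L₁ * L₂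
    constructor
    · rintro (⟨a, ha, b, hb, rfl⟩ | ⟨_, ⟨u, hu, y, rfl, rfl⟩, hz⟩)
      · exact ⟨x ++ a, ha, b, hb, by simp⟩
      · exact ⟨u, hu, y ++ z, hz, by simp⟩
    · rintro ⟨a, ha, b, hb, hab⟩
      rcases List.append_eq_append_iff.1 hab with ⟨y, rfl, rfl⟩ | ⟨y, rfl, rfl⟩
      · exact .inr ⟨_, ⟨a, ha, y, rfl, rfl⟩, hb⟩
      · exact .inl ⟨y, ha, b, hb, rfl⟩

/-- The quotient by `x` is determined by whether `x` is empty and by the set of quotients of `L` by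
what remains of `x` after a prefix in the star. -/
theorem IsRegular.kstar {L : Language α} (h : L.IsRegular) : (KStar.kstar L).IsRegular := by
  refine IsRegular.of_finite_range_leftQuotient
    ((((Set.toFinite (Set.univ : Set Prop)).prod h.finite_range_leftQuotient.finite_subsets).image
      fun p : Prop × Set (Language α) ↦
        ({z | (p.1 ∧ z = []) ∨ ∃ K ∈ p.2, z ∈ K * KStar.kstar L} : Language α)).subset ?_)
  rintro _ ⟨x, rfl⟩
  refine ⟨(x = [], {K | ∃ u ∈ KStar.kstar L, ∃ y, x = u ++ y ∧ K = L.leftQuotient y}),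
    ⟨trivial, ?_⟩, ?_⟩
  · rintro _ ⟨u, -, y, -, rfl⟩
    exact ⟨y, rfl⟩
  · ext z
    change ((x = [] ∧ z = []) ∨ ∃ K, (∃ u ∈ KStar.kstar L, ∃ y, x = u ++ y ∧ K = L.leftQuotient y) ∧
      z ∈ K * KStar.kstar L) ↔ x ++ z ∈ KStar.kstar L
    constructor
    · rintro (⟨rfl, rfl⟩ | ⟨_, ⟨u, hu, y, rfl, rfl⟩, a, ha, b, hb, rfl⟩)
      · exact nil_mem_kstar L
      · obtain ⟨l, rfl, hl⟩ := mem_kstar.1 hu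
        obtain ⟨l', rfl, hl'⟩ := mem_kstar.1 hb
        refine mem_kstar.2 ⟨l ++ [y ++ a] ++ l', by simp, ?_⟩
        intro w hw
        simp only [List.mem_append, List.mem_singleton] at hw
        rcases hw with (hw | rfl) | hw
        exacts [hl _ hw, ha, hl' _ hw]
    · intro hx
      obtain ⟨l, hxl, hl⟩ := mem_kstar.1 hx
      clear hx
      -- Factors are stripped off until one reaches beyond the end of `x`, or `x` is used up.
      induction l generalizing x with
      | nil =>
        left
        simpa using hxl
      | cons p l ih =>
        right
        have hp : p ∈ L := hl p (by simp)
        have hl' : ∀ w ∈ l, w ∈ L := fun w hw ↦ hl w (by simp [hw])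
        rw [List.flatten_cons] at hxl
        rcases List.append_eq_append_iff.1 hxl with ⟨c, rfl, rfl⟩ | ⟨x', rfl, hx'⟩
        · exact ⟨_, ⟨[], nil_mem_kstar L, x, rfl, rfl⟩, c, hp, _, join_mem_kstar hl', rfl⟩
        · rcases ih x' hx'.symm hl' with ⟨rfl, rfl⟩ | ⟨_, ⟨u, hu, y, rfl, rfl⟩, hz⟩
          · exact ⟨_, ⟨[], nil_mem_kstar L, p, by simp, rfl⟩, [],
              by change p ++ [] ∈ L; rwa [List.append_nil], [], nil_mem_kstar L, rfl⟩
          · refine ⟨_, ⟨p ++ u, ?_, y, by simp, rfl⟩, hz⟩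
            obtain ⟨l₁, rfl, hl₁⟩ := mem_kstar.1 hu
            refine mem_kstar.2 ⟨p :: l₁, by simp, ?_⟩
            intro w hw
            rcases List.mem_cons.1 hw with rfl | hw
            exacts [hp, hl₁ _ hw]

end Language

/-! ### Single moves and paths of one-counter transition systems. -/

/-- `CounterMove T p n w q m`: one transition in `T` leads from state `p` and counter `n` to state
`q` and counter `m`, reading `w`. -/
inductive CounterMove {α Q : Type*} (T : Set (Q × Option α × Bool × ℕ × Q)) :
    Q → ℕ → List α → Q → ℕ → Prop
  | empty {p q : Q} {a : Option α} {m : ℕ} (h : (p, a, true, m, q) ∈ T) :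
      CounterMove T p 0 a.toList q m
  | nonempty {p q : Q} {a : Option α} {n m : ℕ} (h : (p, a, false, m, q) ∈ T) :
      CounterMove T p (n + 1) a.toList q (n + m)

/-- `CounterPath T p n w q m`: a sequence of transitions in `T` leads from state `p` and counter `n`
to state `q` and counter `m`, reading `w`. -/
inductive CounterPath {α Q : Type*} (T : Set (Q × Option α × Bool × ℕ × Q)) :
    Q → ℕ → List α → Q → ℕ → Prop
  | refl (p : Q) (n : ℕ) : CounterPath T p n [] p n
  | head {p q r : Q} {n m k : ℕ} {u w : List α} (h : CounterMove T p n u q m)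
      (hp : CounterPath T q m w r k) : CounterPath T p n (u ++ w) r k

section Path

variable {α Q Q' : Type*} {T T' : Set (Q × Option α × Bool × ℕ × Q)} {p q r : Q}
  {n m k : ℕ} {u w : List α}

theorem OneCounterAutomaton.run_iff_counterPath (M : OneCounterAutomaton α Q) :
    M.Run p n w q m ↔ CounterPath M.trans p n w q m := by
  constructor
  · intro h
    induction h with
    | refl => exact .refl _ _
    | stepEmpty ht _ ih => exact .head (.empty ht) ih
    | stepNonempty ht _ ih => exact .head (.nonempty ht) ih
  · intro h
    induction h with
    | refl => exact .refl _ _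
    | head h _ ih =>
      cases h with
      | empty h => exact .stepEmpty h ih
      | nonempty h => exact .stepNonempty h ih

theorem CounterMove.path (h : CounterMove T p n w q m) : CounterPath T p n w q m := by
  simpa using CounterPath.head h (.refl q m)

theorem CounterPath.trans (h : CounterPath T p n u q m) (h' : CounterPath T q m w r k) :
    CounterPath T p n (u ++ w) r k := by
  induction h with
  | refl => exact h'
  | head hm _ ih => rw [List.append_assoc]; exact .head hm (ih h')

/-- Apply a map to the states of a transition. -/
def mapTransition (f : Q → Q') (t : Q × Option α × Bool × ℕ × Q) :
    Q' × Option α × Bool × ℕ × Q' :=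
  (f t.1, t.2.1, t.2.2.1, t.2.2.2.1, f t.2.2.2.2)

theorem counterMove_image {f : Q → Q'} {P R : Q'} :
    CounterMove (mapTransition f '' T) P n w R m ↔
      ∃ p q, P = f p ∧ R = f q ∧ CounterMove T p n w q m := by
  constructor
  · rintro (⟨⟨⟨p, a, z, m, q⟩, ht, he⟩⟩ | ⟨⟨⟨p, a, z, m, q⟩, ht, he⟩⟩) <;>
    · simp only [mapTransition, Prod.mk.injEq] at he
      obtain ⟨rfl, rfl, rfl, rfl, rfl⟩ := he
      first
        | exact ⟨p, q, rfl, rfl, .empty ht⟩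
        | exact ⟨p, q, rfl, rfl, .nonempty ht⟩
  · rintro ⟨p, q, rfl, rfl, ht | ht⟩
    · exact .empty ⟨_, ht, rfl⟩
    · exact .nonempty ⟨_, ht, rfl⟩

theorem counterMove_union :
    CounterMove (T ∪ T') p n w q m ↔ CounterMove T p n w q m ∨ CounterMove T' p n w q m := by
  constructor
  · rintro ((h | h) | (h | h))
    exacts [.inl (.empty h), .inr (.empty h), .inl (.nonempty h), .inr (.nonempty h)]
  · rintro ((h | h) | (h | h))
    exacts [.empty (.inl h), .nonempty (.inl h), .empty (.inr h), .nonempty (.inr h)]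

theorem counterMove_iUnion {ι : Sort*} {T : ι → Set (Q × Option α × Bool × ℕ × Q)} :
    CounterMove (⋃ i, T i) p n w q m ↔ ∃ i, CounterMove (T i) p n w q m := by
  constructor
  · rintro (h | h) <;> obtain ⟨i, hi⟩ := Set.mem_iUnion.1 h
    exacts [⟨i, .empty hi⟩, ⟨i, .nonempty hi⟩]
  · rintro ⟨i, h | h⟩
    exacts [.empty (Set.mem_iUnion.2 ⟨i, h⟩), .nonempty (Set.mem_iUnion.2 ⟨i, h⟩)]

/-- The transitions from `p` to `q` that read `a` and leave the counter as it is. -/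
def idleTransitions (p : Q) (a : Option α) (q : Q) : Set (Q × Option α × Bool × ℕ × Q) :=
  {(p, a, true, 0, q), (p, a, false, 1, q)}

theorem finite_idleTransitions (p : Q) (a : Option α) (q : Q) : (idleTransitions p a q).Finite :=
  (Set.finite_singleton _).insert _

theorem counterMove_idleTransitions {p' q' : Q} {a : Option α} :
    CounterMove (idleTransitions p a q) p' n w q' m ↔ p' = p ∧ q' = q ∧ w = a.toList ∧ n = m := by
  constructor
  · rintro (h | h) <;> simp only [idleTransitions, Set.mem_insert_iff, Set.mem_singleton_iff,
      Prod.mk.injEq] at h <;> simp_all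
  · rintro ⟨rfl, rfl, rfl, rfl⟩
    cases n with
    | zero => exact .empty (by simp [idleTransitions])
    | succ n => exact .nonempty (by simp [idleTransitions])

theorem CounterPath.map {f : Q → Q'} {S : Set (Q' × Option α × Bool × ℕ × Q')}
    (hS : mapTransition f '' T ⊆ S) (h : CounterPath T p n w q m) :
    CounterPath S (f p) n w (f q) m := by
  induction h with
  | refl => exact .refl _ _
  | head hm _ ih =>
    refine .head ?_ ih
    cases hm with
    | empty h => exact .empty (hS ⟨_, h, rfl⟩)
    | nonempty h => exact .nonempty (hS ⟨_, h, rfl⟩)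

theorem CounterMove.mono (hT : T ⊆ T') (h : CounterMove T p n w q m) :
    CounterMove T' p n w q m := by
  cases h with
  | empty h => exact .empty (hT h)
  | nonempty h => exact .nonempty (hT h)

theorem CounterPath.idle {a : Option α} (h : idleTransitions p a q ⊆ T) (n : ℕ) :
    CounterPath T p n a.toList q n :=
  ((counterMove_idleTransitions.2 ⟨rfl, rfl, rfl, rfl⟩).mono h).path

theorem counterMove_singleton {p' q' : Q} {a : Option α} {z : Bool} {j : ℕ} :
    CounterMove {(p, a, z, j, q)} p' n w q' m ↔ p' = p ∧ q' = q ∧ w = a.toList ∧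
      ((z = true ∧ n = 0 ∧ m = j) ∨ (z = false ∧ ∃ i, n = i + 1 ∧ m = i + j)) := by
  constructor
  · rintro (h | h) <;> simp only [Set.mem_singleton_iff, Prod.mk.injEq] at h <;>
      obtain ⟨rfl, rfl, rfl, rfl, rfl⟩ := h
    · exact ⟨rfl, rfl, rfl, .inl ⟨rfl, rfl, rfl⟩⟩
    · exact ⟨rfl, rfl, rfl, .inr ⟨rfl, _, rfl, rfl⟩⟩
  · rintro ⟨rfl, rfl, rfl, ⟨rfl, rfl, rfl⟩ | ⟨rfl, i, rfl, rfl⟩⟩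
    exacts [.empty rfl, .nonempty rfl]

end Path

/-! ### Regular operations on counter relations. -/

/-- A relation between counter values, words and counter values is a counter relation if it is
described by the paths between two states of a finite one-counter automaton. -/
def IsCounterRel {α : Type*} (R : ℕ → List α → ℕ → Prop) : Prop :=
  ∃ (Q : Type) (_ : Finite Q) (T : Set (Q × Option α × Bool × ℕ × Q)) (_ : T.Finite) (s f : Q),
    ∀ n w m, CounterPath T s n w f m ↔ R n w m

/-- Composition of counter relations. -/
def counterSeq {α : Type*} (R S : ℕ → List α → ℕ → Prop) (n : ℕ) (w : List α) (m : ℕ) : Prop :=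
  ∃ u v k, w = u ++ v ∧ R n u k ∧ S k v m

/-- Iteration of a counter relation. -/
inductive CounterStar {α : Type*} (R : ℕ → List α → ℕ → Prop) : ℕ → List α → ℕ → Prop
  | nil (n : ℕ) : CounterStar R n [] n
  | cons {n m k : ℕ} {u w : List α} (h : R n u m) (hs : CounterStar R m w k) :
      CounterStar R n (u ++ w) k

namespace IsCounterRel

variable {α : Type*}

theorem congr {R S : ℕ → List α → ℕ → Prop} (h : IsCounterRel R)
    (hRS : ∀ n w m, R n w m ↔ S n w m) : IsCounterRel S := by
  obtain ⟨Q, hQ, T, hT, s, f, hR⟩ := h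
  exact ⟨Q, hQ, T, hT, s, f, fun n w m ↦ (hR n w m).trans (hRS n w m)⟩

theorem move (a : Option α) (z : Bool) (j : ℕ) :
    IsCounterRel fun n w m ↦ w = a.toList ∧
      ((z = true ∧ n = 0 ∧ m = j) ∨ (z = false ∧ ∃ i, n = i + 1 ∧ m = i + j)) := by
  refine ⟨Bool, inferInstance, {(false, a, z, j, true)}, Set.finite_singleton _, false, true,
    fun n w m ↦ ⟨fun h ↦ ?_, fun h ↦
      (counterMove_singleton.2 ⟨rfl, rfl, h⟩).path⟩⟩
  have key : ∀ P n w P' m, CounterPath {(false, a, z, j, true)} P n w P' m → P' = true →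
      (P = true → w = [] ∧ n = m) ∧ (P = false → w = a.toList ∧
        ((z = true ∧ n = 0 ∧ m = j) ∨ (z = false ∧ ∃ i, n = i + 1 ∧ m = i + j))) := by
    intro P n w P' m h
    induction h with
    | refl P n =>
      rintro rfl
      exact ⟨fun _ ↦ ⟨rfl, rfl⟩, fun hp ↦ (nomatch hp)⟩
    | head hm _ ih =>
      intro hP'
      obtain ⟨ih₁, -⟩ := ih hP'
      obtain ⟨rfl, rfl, rfl, hm'⟩ := counterMove_singleton.1 hm
      refine ⟨fun hp ↦ (nomatch hp), fun _ ↦ ?_⟩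
      obtain ⟨rfl, rfl⟩ := ih₁ rfl
      exact ⟨List.append_nil _, hm'⟩
  exact (key _ _ _ _ _ h rfl).2 rfl

theorem seq {R S : ℕ → List α → ℕ → Prop} (hR : IsCounterRel R) (hS : IsCounterRel S) :
    IsCounterRel (counterSeq R S) := by
  obtain ⟨Q₁, _, T₁, hT₁, s₁, f₁, h₁⟩ := hR
  obtain ⟨Q₂, _, T₂, hT₂, s₂, f₂, h₂⟩ := hS
  set T : Set ((Q₁ ⊕ Q₂) × Option α × Bool × ℕ × (Q₁ ⊕ Q₂)) :=
    mapTransition Sum.inl '' T₁ ∪ mapTransition Sum.inr '' T₂ ∪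
      idleTransitions (.inl f₁) none (.inr s₂) with hT
  refine ⟨Q₁ ⊕ Q₂, inferInstance, T,
    ((hT₁.image _).union (hT₂.image _)).union (finite_idleTransitions _ _ _),
    .inl s₁, .inr f₂, fun n w m ↦ ⟨fun h ↦ ?_, ?_⟩⟩
  -- The end state enters through an equation, so that induction can vary the start. A path from the
  -- left copy to the right one crosses the idle bridge exactly once.
  · have key : ∀ P n w P' m, CounterPath T P n w P' m → P' = .inr f₂ →
        (∀ p, P = .inl p → ∃ u v k, w = u ++ v ∧ CounterPath T₁ p n u f₁ k ∧
          CounterPath T₂ s₂ k v f₂ m) ∧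
        (∀ p, P = .inr p → CounterPath T₂ p n w f₂ m) := by
      intro P n w P' m h
      induction h with
      | refl P n =>
        rintro rfl
        refine ⟨fun p hp ↦ (nomatch hp), fun p hp ↦ ?_⟩
        cases hp
        exact .refl _ _
      | head hm _ ih =>
        intro hP'
        obtain ⟨ih₁, ih₂⟩ := ih hP'
        rw [hT, counterMove_union, counterMove_union, counterMove_image, counterMove_image,
          counterMove_idleTransitions] at hm
        rcases hm with (⟨p, q, rfl, rfl, hm⟩ | ⟨p, q, rfl, rfl, hm⟩) | ⟨rfl, rfl, rfl, rfl⟩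
        · refine ⟨fun p' hp ↦ ?_, fun p' hp ↦ (nomatch hp)⟩
          cases hp
          obtain ⟨u, v, k, rfl, hu, hv⟩ := ih₁ q rfl
          exact ⟨_, v, k, (List.append_assoc ..).symm, .head hm hu, hv⟩
        · refine ⟨fun p' hp ↦ (nomatch hp), fun p' hp ↦ ?_⟩
          cases hp
          exact .head hm (ih₂ q rfl)
        · refine ⟨fun p' hp ↦ ?_, fun p' hp ↦ (nomatch hp)⟩
          cases hp
          exact ⟨[], _, _, rfl, .refl _ _, ih₂ _ rfl⟩
    obtain ⟨u, v, k, rfl, hu, hv⟩ := (key _ _ _ _ _ h rfl).1 _ rfl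
    exact ⟨u, v, k, rfl, (h₁ _ _ _).1 hu, (h₂ _ _ _).1 hv⟩
  · rintro ⟨u, v, k, rfl, hu, hv⟩
    refine (((h₁ _ _ _).2 hu).map fun t ht ↦ .inl (.inl ht)).trans ?_
    exact (CounterPath.idle (a := none) (fun t ht ↦ .inr ht) k).trans
      (((h₂ _ _ _).2 hv).map fun t ht ↦ .inl (.inr ht))

theorem iUnion {ι : Type} [Finite ι] {R : ι → ℕ → List α → ℕ → Prop}
    (hR : ∀ i, IsCounterRel (R i)) : IsCounterRel fun n w m ↦ ∃ i, R i n w m := by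
  choose Q hQ T hT s f h using hR
  let inj (i : ι) (q : Q i) : Option (Option (Σ i, Q i)) := some (some ⟨i, q⟩)
  set S : Set (Option (Option (Σ i, Q i)) × Option α × Bool × ℕ × Option (Option (Σ i, Q i))) :=
    ⋃ i, (mapTransition (inj i) '' T i ∪ idleTransitions none none (inj i (s i)) ∪
      idleTransitions (inj i (f i)) none (some none)) with hS
  refine ⟨_, inferInstance, S, Set.finite_iUnion fun i ↦ (((hT i).image _).union
    (finite_idleTransitions _ _ _)).union (finite_idleTransitions _ _ _), none, some none,
    fun n w m ↦ ⟨fun hp ↦ ?_, ?_⟩⟩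
  · have key : ∀ P n w P' m, CounterPath S P n w P' m → P' = some none →
        (P = some none → w = [] ∧ n = m) ∧
        (∀ i p, P = inj i p → CounterPath (T i) p n w (f i) m) ∧
        (P = none → ∃ i, CounterPath (T i) (s i) n w (f i) m) := by
      intro P n w P' m h
      induction h with
      | refl P n =>
        rintro rfl
        exact ⟨fun _ ↦ ⟨rfl, rfl⟩, fun i p hp ↦ (nomatch hp), fun hp ↦ (nomatch hp)⟩
      | head hm _ ih =>
        intro hP'
        obtain ⟨ih₁, ih₂, ih₃⟩ := ih hP'
        rw [hS, counterMove_iUnion] at hm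
        obtain ⟨i, hm⟩ := hm
        rw [counterMove_union, counterMove_union, counterMove_image,
          counterMove_idleTransitions, counterMove_idleTransitions] at hm
        rcases hm with (⟨p, q, rfl, rfl, hm⟩ | ⟨rfl, rfl, rfl, rfl⟩) | ⟨rfl, rfl, rfl, rfl⟩
        · refine ⟨fun hp ↦ (nomatch hp), fun i p hp ↦ ?_, fun hp ↦ (nomatch hp)⟩
          cases hp
          exact .head hm (ih₂ _ q rfl)
        · refine ⟨fun hp ↦ (nomatch hp), fun i p hp ↦ (nomatch hp), fun _ ↦ ⟨i, ih₂ _ _ rfl⟩⟩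
        · refine ⟨fun hp ↦ (nomatch hp), fun i p hp ↦ ?_, fun hp ↦ (nomatch hp)⟩
          cases hp
          obtain ⟨rfl, rfl⟩ := ih₁ rfl
          exact .refl _ _
    obtain ⟨i, hi⟩ := (key _ _ _ _ _ hp rfl).2.2 rfl
    exact ⟨i, (h i _ _ _).1 hi⟩
  · rintro ⟨i, hi⟩
    have h₁ : CounterPath S none n [] (inj i (s i)) n :=
      CounterPath.idle (a := none) (fun t ht ↦ Set.mem_iUnion.2 ⟨i, .inl (.inr ht)⟩) n
    have h₂ : CounterPath S (inj i (s i)) n w (inj i (f i)) m :=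
      ((h i _ _ _).2 hi).map fun t ht ↦ Set.mem_iUnion.2 ⟨i, .inl (.inl ht)⟩
    have h₃ : CounterPath S (inj i (f i)) m [] (some none) m :=
      CounterPath.idle (a := none) (fun t ht ↦ Set.mem_iUnion.2 ⟨i, .inr ht⟩) m
    simpa using (h₁.trans h₂).trans h₃

theorem or {R S : ℕ → List α → ℕ → Prop} (hR : IsCounterRel R) (hS : IsCounterRel S) :
    IsCounterRel fun n w m ↦ R n w m ∨ S n w m := by
  refine (iUnion (ι := Bool) (R := fun b ↦ bif b then R else S) ?_).congr ?_
  · rintro (_ | _)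
    exacts [hS, hR]
  · simp [or_comm]

/-- A fresh state is both start and end, and the rounds are delimited by the visits to it; `s` and
`f` cannot play this role, as they may be revisited in the middle of a round. -/
theorem star {R : ℕ → List α → ℕ → Prop} (hR : IsCounterRel R) : IsCounterRel (CounterStar R) := by
  obtain ⟨Q, _, T, hT, s, f, h⟩ := hR
  set S : Set (Option Q × Option α × Bool × ℕ × Option Q) :=
    mapTransition some '' T ∪ idleTransitions none none (some s) ∪
      idleTransitions (some f) none none with hS
  refine ⟨Option Q, inferInstance, S, ((hT.image _).union
    (finite_idleTransitions _ _ _)).union (finite_idleTransitions _ _ _), none, none,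
    fun n w m ↦ ⟨fun hp ↦ ?_, fun hp ↦ ?_⟩⟩
  · have key : ∀ P n w P' m, CounterPath S P n w P' m → P' = none →
        (P = none → CounterStar R n w m) ∧
        (∀ p, P = some p → ∃ u v k, w = u ++ v ∧ CounterPath T p n u f k ∧
          CounterStar R k v m) := by
      intro P n w P' m h'
      induction h' with
      | refl P n =>
        rintro rfl
        exact ⟨fun _ ↦ .nil n, fun p hp ↦ (nomatch hp)⟩
      | head hm _ ih =>
        intro hP'
        obtain ⟨ih₁, ih₂⟩ := ih hP'
        rw [hS, counterMove_union, counterMove_union, counterMove_image,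
          counterMove_idleTransitions, counterMove_idleTransitions] at hm
        rcases hm with (⟨p, q, rfl, rfl, hm⟩ | ⟨rfl, rfl, rfl, rfl⟩) | ⟨rfl, rfl, rfl, rfl⟩
        · refine ⟨fun hp ↦ (nomatch hp), fun p hp ↦ ?_⟩
          cases hp
          obtain ⟨u, v, k, rfl, hu, hv⟩ := ih₂ q rfl
          exact ⟨_, v, k, (List.append_assoc ..).symm, .head hm hu, hv⟩
        · refine ⟨fun _ ↦ ?_, fun p hp ↦ (nomatch hp)⟩
          obtain ⟨u, v, k, rfl, hu, hv⟩ := ih₂ _ rfl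
          exact CounterStar.cons (u := u) ((h _ _ _).1 hu) hv
        · refine ⟨fun hp ↦ (nomatch hp), fun p hp ↦ ?_⟩
          cases hp
          exact ⟨[], _, _, rfl, .refl _ _, ih₁ rfl⟩
    exact (key _ _ _ _ _ hp rfl).1 rfl
  · induction hp with
    | nil n => exact .refl _ _
    | @cons n m k u w hu _ ih =>
      have h₁ : CounterPath S none n [] (some s) n :=
        CounterPath.idle (a := none) (fun t ht ↦ .inl (.inr ht)) n
      have h₂ : CounterPath S (some s) n u (some f) m :=
        ((h _ _ _).2 hu).map fun t ht ↦ .inl (.inl ht)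
      have h₃ : CounterPath S (some f) m [] none m :=
        CounterPath.idle (a := none) (fun t ht ↦ .inr ht) m
      simpa using ((h₁.trans h₂).trans h₃).trans ih

theorem of_isRegular [Finite α] {L : Language α} (hL : L.IsRegular) :
    IsCounterRel fun n w m ↦ w ∈ L ∧ n = m := by
  obtain ⟨σ, _, M, rfl⟩ := hL
  set T : Set (Option σ × Option α × Bool × ℕ × Option σ) :=
    (⋃ q : σ, ⋃ a : α, idleTransitions (some q) (some a) (some (M.step q a))) ∪
      ⋃ q : M.accept, idleTransitions (some q) none none with hT
  refine ⟨Option σ, inferInstance, T, (Set.finite_iUnion fun _ ↦ Set.finite_iUnion fun _ ↦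
    finite_idleTransitions _ _ _).union (Set.finite_iUnion fun _ ↦ finite_idleTransitions _ _ _),
    some M.start, none, fun n w m ↦ ⟨fun hp ↦ ?_, ?_⟩⟩
  · have key : ∀ P n w P' m, CounterPath T P n w P' m → P' = none →
        (P = none → w = [] ∧ n = m) ∧ (∀ q, P = some q → w ∈ M.acceptsFrom q ∧ n = m) := by
      intro P n w P' m h
      induction h with
      | refl P n =>
        rintro rfl
        exact ⟨fun _ ↦ ⟨rfl, rfl⟩, fun q hq ↦ (nomatch hq)⟩
      | head hm _ ih =>
        intro hP'
        obtain ⟨ih₁, ih₂⟩ := ih hP'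
        rw [hT, counterMove_union, counterMove_iUnion, counterMove_iUnion] at hm
        rcases hm with ⟨q, hm⟩ | ⟨⟨q, hq⟩, hm⟩
        · rw [counterMove_iUnion] at hm
          obtain ⟨a, hm⟩ := hm
          obtain ⟨rfl, rfl, rfl, rfl⟩ := counterMove_idleTransitions.1 hm
          refine ⟨fun hp ↦ (nomatch hp), fun q hq ↦ ?_⟩
          cases hq
          exact ih₂ _ rfl
        · obtain ⟨rfl, rfl, rfl, rfl⟩ := counterMove_idleTransitions.1 hm
          refine ⟨fun hp ↦ (nomatch hp), fun q hq ↦ ?_⟩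
          cases hq
          obtain ⟨rfl, rfl⟩ := ih₁ rfl
          exact ⟨hq, rfl⟩
    exact (key _ _ _ _ _ hp rfl).2 _ rfl
  · rintro ⟨hw, rfl⟩
    have key : ∀ (w : List α) (q : σ), M.evalFrom q w ∈ M.accept →
        CounterPath T (some q) n w none n := by
      intro w
      induction w with
      | nil =>
        intro q hq
        exact CounterPath.idle (a := none)
          (fun t ht ↦ .inr (Set.mem_iUnion.2 ⟨⟨q, hq⟩, ht⟩)) n
      | cons a w ih =>
        intro q hq
        exact (CounterPath.idle (a := some a) (fun t ht ↦ .inl (Set.mem_iUnion.2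
          ⟨q, Set.mem_iUnion.2 ⟨a, ht⟩⟩)) n).trans (ih _ hq)
    exact key w M.start hw

/-- The words accepted by a counter relation started with the empty stack. -/
theorem isCounterLanguage {R : ℕ → List α → ℕ → Prop} (hR : IsCounterRel R) {L : Language α}
    (hL : ∀ w, w ∈ L ↔ ∃ m, R 0 w m) : IsCounterLanguage L := by
  obtain ⟨Q, hQ, T, hT, s, f, h⟩ := hR
  refine ⟨Q, hQ, ⟨s, {f}, T, hT⟩, ?_⟩
  ext w
  rw [hL]
  constructor
  · rintro ⟨q, rfl, n, hr⟩
    exact ⟨n, (h _ _ _).1 ((OneCounterAutomaton.run_iff_counterPath _).1 hr)⟩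
  · rintro ⟨m, hm⟩
    exact ⟨f, rfl, m, (OneCounterAutomaton.run_iff_counterPath _).2 ((h _ _ _).2 hm)⟩

end IsCounterRel

/-! ### Arithmetic on the counter. -/

namespace IsCounterRel

variable {α : Type*}

theorem add (a : Option α) (k : ℕ) : IsCounterRel fun n w m ↦ w = a.toList ∧ m = n + k := by
  -- On a nonempty stack one letter is popped first, hence `k + 1`.
  refine ((move a true k).or (move a false (k + 1))).congr fun n w m ↦ ?_
  rcases n with _ | n
  · simp
  · simp; omega

theorem zero : IsCounterRel fun n (w : List α) m ↦ w = [] ∧ n = 0 ∧ m = 0 :=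
  (move none true 0).congr fun n w m ↦ by simp

theorem sub (a : Option α) (k : ℕ) : IsCounterRel fun n w m ↦ w = a.toList ∧ n = m + k := by
  induction k with
  | zero =>
    refine (add a 0).congr fun n w m ↦ ?_
    simp [eq_comm]
  | succ k ih =>
    refine ((move none false 0).seq ih).congr fun n w m ↦ ?_
    constructor
    · rintro ⟨u, v, j, rfl, ⟨rfl, ⟨⟨⟩, -⟩ | ⟨-, i, rfl, rfl⟩⟩, rfl, h⟩
      · exact ⟨by simp, by omega⟩
    · rintro ⟨rfl, rfl⟩
      exact ⟨[], _, m + k, rfl, ⟨rfl, .inr ⟨rfl, m + k, by omega, rfl⟩⟩, rfl, rfl⟩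

end IsCounterRel

/-! ### Locating a position in a morphic image with the counter. -/

theorem List.flatMap_getElem?_eq_some {σ δ : Type*} (f : σ → List δ) (u : List σ) (i : ℕ) (c : δ) :
    (u.flatMap f)[i]? = some c ↔ ∃ u₁ a u₂ j, u = u₁ ++ a :: u₂ ∧
      i = (u₁.flatMap f).length + j ∧ (f a)[j]? = some c := by
  constructor
  · intro h
    induction u generalizing i with
    | nil => simp at h
    | cons a u ih =>
      rw [List.flatMap_cons] at h
      by_cases hi : i < (f a).length
      · rw [List.getElem?_append_left hi] at h
        exact ⟨[], a, u, i, rfl, by simp, h⟩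
      · rw [List.getElem?_append_right (not_lt.1 hi)] at h
        obtain ⟨u₁, b, u₂, j, rfl, hj, hc⟩ := ih _ h
        refine ⟨a :: u₁, b, u₂, j, rfl, ?_, hc⟩
        rw [List.flatMap_cons, List.length_append]
        omega
  · rintro ⟨u₁, a, u₂, j, rfl, rfl, h⟩
    rw [List.flatMap_append, List.getElem?_append_right (by omega), Nat.add_sub_cancel_left,
      List.flatMap_cons, List.getElem?_append_left, h]
    exact (List.getElem?_eq_some_iff.1 h).1

section Positions

variable {σ δ : Type} [Finite σ] (f : σ → List δ)

theorem isCounterRel_lengthUp : IsCounterRel fun n (w : List (Option σ)) m ↦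
    ∃ u : List σ, w = u.map some ∧ m = n + (u.flatMap f).length := by
  refine (IsCounterRel.iUnion fun a : σ ↦
    IsCounterRel.add (some (some a)) (f a).length).star.congr fun n w m ↦ ⟨fun h ↦ ?_, ?_⟩
  · induction h with
    | nil n => exact ⟨[], rfl, rfl⟩
    | cons h _ ih =>
      obtain ⟨a, rfl, rfl⟩ := h
      obtain ⟨u, rfl, rfl⟩ := ih
      exact ⟨a :: u, rfl, by simp [Nat.add_assoc]⟩
  · rintro ⟨u, rfl, rfl⟩
    induction u generalizing n with
    | nil => exact .nil _
    | cons a u ih =>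
      refine .cons (u := [some a]) ⟨a, rfl, rfl⟩ ?_
      rw [List.flatMap_cons, List.length_append, ← Nat.add_assoc]
      exact ih _

theorem isCounterRel_lengthDown : IsCounterRel fun n (w : List (Option σ)) m ↦
    ∃ u : List σ, w = u.map some ∧ n = m + (u.flatMap f).length := by
  refine (IsCounterRel.iUnion fun a : σ ↦
    IsCounterRel.sub (some (some a)) (f a).length).star.congr fun n w m ↦ ⟨fun h ↦ ?_, ?_⟩
  · induction h with
    | nil n => exact ⟨[], rfl, rfl⟩
    | cons h _ ih =>
      obtain ⟨a, rfl, rfl⟩ := h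
      obtain ⟨u, rfl, rfl⟩ := ih
      exact ⟨a :: u, rfl, by simp; omega⟩
  · rintro ⟨u, rfl, rfl⟩
    induction u with
    | nil => exact .nil _
    | cons a u ih =>
      refine .cons (u := [some a]) ⟨a, rfl, ?_⟩ ih
      rw [List.flatMap_cons, List.length_append]
      omega

theorem isCounterRel_letters : IsCounterRel fun n (w : List (Option σ)) m ↦
    (∃ u : List σ, w = u.map some) ∧ n = m :=
  IsCounterRel.of_isRegular Language.isRegular_map_some

theorem isCounterRel_increase {α : Type*} : IsCounterRel fun n (w : List α) m ↦ w = [] ∧ n ≤ m := by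
  refine (IsCounterRel.add none 1).star.congr fun n w m ↦ ⟨fun h ↦ ?_, ?_⟩
  · induction h with
    | nil n => exact ⟨rfl, le_rfl⟩
    | cons h _ ih =>
      obtain ⟨rfl, rfl⟩ := h
      exact ⟨ih.1, by omega⟩
  · rintro ⟨rfl, h⟩
    obtain ⟨d, rfl⟩ := Nat.exists_eq_add_of_le h
    clear h
    induction d generalizing n with
    | zero => exact .nil _
    | succ d ih =>
      rw [Nat.add_comm d, ← Nat.add_assoc]
      exact .cons (u := []) ⟨rfl, rfl⟩ (ih (n + 1))

/-- A position splits into a sum of image lengths, which the counter accumulates, and an offset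
inside the image of one letter, which is bounded and can be guessed. For `none`, an index past the
end, the whole length is added and then any further amount. -/
theorem isCounterRel_positionUp (o : Option δ) : IsCounterRel fun n (w : List (Option σ)) m ↦
    ∃ u : List σ, w = u.map some ∧ ∃ i, m = n + i ∧ (u.flatMap f)[i]? = o := by
  rcases o with _ | c
  · refine ((isCounterRel_lengthUp f).seq isCounterRel_increase).congr fun n w m ↦ ?_
    simp only [List.getElem?_eq_none_iff]
    constructor
    · rintro ⟨_, _, k, rfl, ⟨u, rfl, rfl⟩, rfl, hk⟩
      exact ⟨u, by simp, m - n, by omega, by omega⟩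
    · rintro ⟨u, rfl, i, rfl, hi⟩
      exact ⟨_, [], _, by simp, ⟨u, rfl, rfl⟩, rfl, by omega⟩
  · refine ((isCounterRel_lengthUp f).seq ((IsCounterRel.iUnion
      fun p : {p : Σ a, Fin (f a).length // (f p.1)[p.2]? = some c} ↦
        IsCounterRel.add (some (some p.1.1)) p.1.2).seq isCounterRel_letters)).congr fun n w m ↦ ?_
    simp only [List.flatMap_getElem?_eq_some]
    constructor
    · rintro ⟨_, _, k, rfl, ⟨u₁, rfl, rfl⟩, _, _, l, rfl, ⟨⟨⟨a, j⟩, hc⟩, rfl, rfl⟩, ⟨u₂, rfl⟩, rfl⟩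
      exact ⟨u₁ ++ a :: u₂, by simp, _, Nat.add_assoc .., u₁, a, u₂, j, rfl, rfl, hc⟩
    · rintro ⟨_, rfl, _, rfl, u₁, a, u₂, j, rfl, rfl, hc⟩
      exact ⟨_, _, _, List.map_append, ⟨u₁, rfl, rfl⟩, [some a], _, _, rfl,
        ⟨⟨⟨a, ⟨j, (List.getElem?_eq_some_iff.1 hc).1⟩⟩, hc⟩, rfl, rfl⟩, ⟨u₂, rfl⟩,
        Nat.add_assoc ..⟩

/-- For a letter, image lengths and a guessed offset are subtracted and a zero test confirms the
position; for `none`, it is enough that the whole length can be subtracted. The final counter value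
is irrelevant, so it stays quantified. -/
theorem exists_isCounterRel_positionDown (o : Option δ) :
    ∃ R : ℕ → List (Option σ) → ℕ → Prop, IsCounterRel R ∧ ∀ n w, (∃ m, R n w m) ↔
      ∃ u : List σ, w = u.map some ∧ (u.flatMap f)[n]? = o := by
  rcases o with _ | c
  · refine ⟨_, isCounterRel_lengthDown f, fun n w ↦ ?_⟩
    simp only [List.getElem?_eq_none_iff]
    constructor
    · rintro ⟨m, u, rfl, rfl⟩
      exact ⟨u, rfl, by omega⟩
    · rintro ⟨u, rfl, hu⟩
      exact ⟨_, u, rfl, (Nat.sub_add_cancel hu).symm⟩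
  · refine ⟨_, (isCounterRel_lengthDown f).seq ((IsCounterRel.iUnion
      fun p : {p : Σ a, Fin (f a).length // (f p.1)[p.2]? = some c} ↦
        IsCounterRel.sub (some (some p.1.1)) p.1.2).seq
          (IsCounterRel.zero.seq isCounterRel_letters)), fun n w ↦ ?_⟩
    simp only [List.flatMap_getElem?_eq_some]
    constructor
    · rintro ⟨m, _, _, k, rfl, ⟨u₁, rfl, rfl⟩, _, _, l, rfl, ⟨⟨⟨a, j⟩, hc⟩, rfl, rfl⟩,
        _, _, _, rfl, ⟨rfl, rfl, rfl⟩, ⟨u₂, rfl⟩, rfl⟩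
      exact ⟨u₁ ++ a :: u₂, by simp, u₁, a, u₂, j, rfl, by simp [Nat.add_comm], hc⟩
    · rintro ⟨_, rfl, u₁, a, u₂, j, rfl, rfl, hc⟩
      exact ⟨0, _, _, _, List.map_append, ⟨u₁, rfl, Nat.add_comm ..⟩, [some a], _, 0, rfl,
        ⟨⟨⟨a, ⟨j, (List.getElem?_eq_some_iff.1 hc).1⟩⟩, hc⟩, rfl, by simp⟩,
        [], _, 0, rfl, ⟨rfl, rfl, rfl⟩, ⟨u₂, rfl⟩, rfl⟩

/-- Comparing `[i]?` covers differing letters and differing lengths at once. There are finitely many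
pairs of unequal values in `Option δ`, so the states can remember the guessed pair and the counter
only carries the index. -/
theorem exists_isCounterRel_hashWord_ne [Finite δ] (f' : σ → List δ) :
    ∃ R : ℕ → List (Option σ) → ℕ → Prop, IsCounterRel R ∧ ∀ w, (∃ m, R 0 w m) ↔
      ∃ u v : List σ, w = hashWord u v ∧ u.flatMap f ≠ v.flatMap f' := by
  choose D hD hD' using fun o : Option δ ↦ exists_isCounterRel_positionDown f' o
  have hash := IsCounterRel.add (some (none : Option σ)) 0
  refine ⟨_, IsCounterRel.iUnion fun p : {p : Option δ × Option δ // p.1 ≠ p.2} ↦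
    (isCounterRel_positionUp f p.1.1).seq (hash.seq ((hD p.1.2).seq hash)), fun w ↦ ⟨?_, ?_⟩⟩
  · rintro ⟨m, ⟨⟨o, o'⟩, ho⟩, _, _, k, rfl, ⟨u, rfl, i, rfl, hu⟩, _, _, l, rfl, ⟨rfl, rfl⟩,
      x, _, r, rfl, hr, rfl, rfl⟩
    obtain ⟨v, rfl, hv⟩ := (hD' o' _ _).1 ⟨_, hr⟩
    refine ⟨u, v, by simp [hashWord], fun h ↦ ho ?_⟩
    rw [← hu, ← hv, h]
    simp
  · rintro ⟨u, v, rfl, h⟩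
    obtain ⟨i, hi⟩ : ∃ i, (u.flatMap f)[i]? ≠ (v.flatMap f')[i]? := by
      by_contra! hi
      exact h (List.ext_getElem? hi)
    obtain ⟨r, hr⟩ := (hD' ((v.flatMap f')[i]?) i (v.map some)).2 ⟨v, rfl, rfl⟩
    refine ⟨r, ⟨⟨_, _⟩, hi⟩, u.map some, none :: (v.map some ++ [none]), i, by simp [hashWord],
      ⟨u, rfl, i, by simp, rfl⟩, [none], _, i, rfl, ⟨rfl, rfl⟩, _, [none], r, rfl, hr, rfl, rfl⟩

end Positions

/-! ### The language of an instance of the Post correspondence problem. -/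

section Pcp

variable {σ δ : Type}

variable (σ) in
/-- The words of the form `u#v#`. -/
def hashWordLanguage : Language (Option σ) := {w | ∃ u v : List σ, w = hashWord u v}

theorem isRegular_hashWordLanguage : (hashWordLanguage σ).IsRegular := by
  have hS := Language.isRegular_map_some (α := σ)
  have hN := Language.isRegular_singleton_letter (none : Option σ)
  have h := ((hS.mul hN).mul hS).mul hN
  refine (congrArg Language.IsRegular (Set.ext fun w ↦ ?_)).mpr h
  constructor
  · rintro ⟨u, v, rfl⟩
    exact ⟨_, ⟨_, ⟨_, ⟨u, rfl⟩, _, rfl, rfl⟩, _, ⟨v, rfl⟩, rfl⟩, _, rfl, rfl⟩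
  · rintro ⟨_, ⟨_, ⟨_, ⟨u, rfl⟩, _, rfl, rfl⟩, _, ⟨v, rfl⟩, rfl⟩, _, rfl, rfl⟩
    exact ⟨u, v, rfl⟩

theorem notMem_hashWordLanguage {w : List (Option σ)} :
    w ∈ (hashWordLanguage σ)ᶜ ↔ ∀ u v : List σ, w ≠ hashWord u v := by
  change (¬ ∃ u v : List σ, w = hashWord u v) ↔ _
  push Not
  rfl

theorem FreeMonoid.map_ofList (g : FreeMonoid σ →* FreeMonoid δ) (u : List σ) :
    g (FreeMonoid.ofList u) =
      FreeMonoid.ofList (u.flatMap fun a ↦ (g (FreeMonoid.of a)).toList) := by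
  induction u with
  | nil => exact map_one g
  | cons a u ih => rw [FreeMonoid.ofList_cons, map_mul, ih]; rfl

theorem map_some_append_none_inj {α : Type*} {u u' : List α} {x x' : List (Option α)}
    (h : u.map some ++ none :: x = u'.map some ++ none :: x') : u = u' ∧ x = x' := by
  induction u generalizing u' with
  | nil => rcases u' with _ | ⟨a, u'⟩ <;> simp_all
  | cons a u ih =>
    rcases u' with _ | ⟨a', u'⟩
    · simp at h
    · simp only [List.map_cons, List.cons_append, List.cons.injEq, Option.some.injEq] at h
      obtain ⟨rfl, h⟩ := h
      obtain ⟨rfl, rfl⟩ := ih h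
      exact ⟨rfl, rfl⟩

theorem hashWord_injective {u v u' v' : List σ} (h : hashWord u v = hashWord u' v') :
    u = u' ∧ v = v' := by
  obtain ⟨rfl, h'⟩ := map_some_append_none_inj (x := v.map some ++ [none])
    (x' := v'.map some ++ [none]) (by simpa [hashWord] using h)
  exact ⟨rfl, (map_some_append_none_inj (x := []) (x' := []) h').1⟩

theorem exists_eq_map_some {α : Type*} {w : List (Option α)} (h : none ∉ w) :
    ∃ t : List α, w = t.map some := by
  induction w with
  | nil => exact ⟨[], rfl⟩
  | cons a w ih =>
    rw [List.mem_cons, not_or] at h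
    obtain ⟨t, rfl⟩ := ih h.2
    obtain ⟨b, rfl⟩ := Option.ne_none_iff_exists'.1 (Ne.symm h.1)
    exact ⟨b :: t, rfl⟩

/-- The square ends with #, so `w` does too; as there are two # in all, `w` has no other, and it is
t# for a word t without #. -/
theorem eq_of_square_eq_hashWord {w : List (Option σ)} {u v : List σ}
    (h : w ++ w = hashWord u v) : u = v := by
  classical
  rcases w.eq_nil_or_concat with rfl | ⟨w, a, rfl⟩
  · simp [hashWord] at h
  have hcount (t : List σ) : (t.map some).count none = 0 := by simp [List.count_eq_zero]
  obtain rfl : a = none := by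
    rw [List.concat_eq_append, ← List.append_assoc] at h
    simpa using (List.append_inj' h rfl).2
  have hw : w.count none = 0 := by
    have := congrArg (List.count none) h
    simp [hashWord, hcount] at this
    omega
  obtain ⟨t, rfl⟩ := exists_eq_map_some (List.count_eq_zero.1 hw)
  have ht : hashWord t t = hashWord u v := by
    rw [← h]
    simp [hashWord]
  obtain ⟨rfl, rfl⟩ := hashWord_injective ht
  rfl

theorem exists_isCounterRel_pcp [Finite σ] [Finite δ] (g h : FreeMonoid σ →* FreeMonoid δ) :
    ∃ R : ℕ → List (Option σ) → ℕ → Prop, IsCounterRel R ∧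
      ∀ w, w ∈ pcpLanguage g h ↔ ∃ m, R 0 w m := by
  obtain ⟨R₁, hR₁, h₁⟩ := exists_isCounterRel_hashWord_ne (fun a : σ ↦ [a]) fun a ↦ [a]
  obtain ⟨R₂, hR₂, h₂⟩ := exists_isCounterRel_hashWord_ne
    (fun a : σ ↦ (g (FreeMonoid.of a)).toList) fun a ↦ (h (FreeMonoid.of a)).toList
  refine ⟨_, (IsCounterRel.of_isRegular isRegular_hashWordLanguage.compl).or (hR₁.or hR₂),
    fun w ↦ ?_⟩
  rw [exists_or, exists_or, h₁, h₂, exists_and_left, and_iff_left ⟨_, rfl⟩,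
    notMem_hashWordLanguage]
  refine or_congr Iff.rfl ?_
  simp only [FreeMonoid.map_ofList, ← exists_or, ← and_or_left]
  simp [List.flatMap_singleton']

theorem square_mem_pcpLanguage_iff (g h : FreeMonoid σ →* FreeMonoid δ) (w : List (Option σ)) :
    w ++ w ∈ pcpLanguage g h ↔ ¬ ∃ u : List σ, w ++ w = hashWord u u ∧
      g (FreeMonoid.ofList u) = h (FreeMonoid.ofList u) := by
  constructor
  · rintro (hw | ⟨u, v, hw, hne⟩) ⟨u', hw', he⟩
    · exact hw _ _ hw'
    · obtain ⟨rfl, rfl⟩ := hashWord_injective (hw.symm.trans hw')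
      exact hne.elim (· rfl) (· he)
  · intro hw
    by_cases hf : ∀ u v : List σ, w ++ w ≠ hashWord u v
    · exact .inl hf
    · push Not at hf
      obtain ⟨u, v, hu⟩ := hf
      obtain rfl := eq_of_square_eq_hashWord hu
      exact .inr ⟨u, u, hu, .inr fun he ↦ hw ⟨u, hu, he⟩⟩

theorem squares_le_pcpLanguage_iff (g h : FreeMonoid σ →* FreeMonoid δ) :
    copyLanguage (⊤ : Language (Option σ)) ≤ pcpLanguage g h + {hashWord [] []} ↔
      ¬ ∃ u : FreeMonoid σ, u ≠ 1 ∧ g u = h u := by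
  constructor
  · rintro hle ⟨u, hu, he⟩
    have hmem : hashWord u.toList u.toList ∈ copyLanguage (⊤ : Language (Option σ)) :=
      ⟨u.toList.map some ++ [none], trivial, by simp [hashWord]⟩
    have hsq : hashWord u.toList u.toList =
        (u.toList.map some ++ [none]) ++ (u.toList.map some ++ [none]) := by simp [hashWord]
    rcases hle hmem with hp | hp
    · rw [hsq] at hp
      exact (square_mem_pcpLanguage_iff g h _).1 hp ⟨u.toList, hsq.symm, he⟩
    · exact hu (hashWord_injective hp).1
  · rintro hno _ ⟨w, -, rfl⟩
    by_cases hw : w ++ w ∈ pcpLanguage g h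
    · exact .inl hw
    · rw [square_mem_pcpLanguage_iff, not_not] at hw
      obtain ⟨u, hu, he⟩ := hw
      refine .inr ?_
      by_cases h1 : u = []
      · subst h1
        exact hu
      · exact absurd ⟨FreeMonoid.ofList u, h1, he⟩ hno

theorem isCounterLanguage_pcpLanguage [Finite σ] [Finite δ]
    (g h : FreeMonoid σ →* FreeMonoid δ) : IsCounterLanguage (pcpLanguage g h) := by
  obtain ⟨R, hR, hL⟩ := exists_isCounterRel_pcp g h
  exact hR.isCounterLanguage hL

theorem isCounterLanguage_pcpLanguage_add [Finite σ] [Finite δ]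
    (g h : FreeMonoid σ →* FreeMonoid δ) :
    IsCounterLanguage (pcpLanguage g h + {hashWord [] []}) := by
  obtain ⟨R, hR, hL⟩ := exists_isCounterRel_pcp g h
  have hash := IsCounterRel.add (some (none : Option σ)) 0
  refine (hR.or (hash.seq hash)).isCounterLanguage fun w ↦ ?_
  rw [exists_or, ← hL]
  refine or_congr Iff.rfl ⟨?_, ?_⟩
  · rintro rfl
    exact ⟨0, [none], [none], 0, rfl, ⟨rfl, rfl⟩, rfl, rfl⟩
  · rintro ⟨_, _, _, _, rfl, ⟨rfl, -⟩, rfl, -⟩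
    rfl

end Pcp

/-! ### Register programs as regular languages of operations. -/

/-- The operations on a counter: increment, decrement and test for zero. -/
inductive CounterOp
  | inc
  | dec
  | test

instance : Finite CounterOp :=
  Finite.of_injective (fun o : CounterOp ↦ (match o with | .inc => 0 | .dec => 1 | .test => 2 : Fin 3))
    (by rintro (_ | _ | _) (_ | _ | _) h <;> first | rfl | cases h)

/-- The effect of an operation on a counter; `none` if the operation is not applicable. -/
def CounterOp.apply : CounterOp → ℕ → Option ℕ
  | inc, n => some (n + 1)
  | dec, 0 => none
  | dec, n + 1 => some n
  | test, 0 => some 0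
  | test, _ + 1 => none

/-- The effect on the register `r` of a sequence of operations on registers. -/
def simulate {ι : Type*} [DecidableEq ι] (r : ι) : List (ι × CounterOp) → ℕ → Option ℕ
  | [], n => some n
  | (s, o) :: x, n => if s = r then (o.apply n).bind (simulate r x) else simulate r x n

theorem simulate_append {ι : Type*} [DecidableEq ι] (r : ι) (x y : List (ι × CounterOp)) (n : ℕ) :
    simulate r (x ++ y) n = (simulate r x n).bind (simulate r y) := by
  induction x generalizing n with
  | nil => rfl
  | cons a x ih =>
    obtain ⟨s, o⟩ := a
    simp only [List.cons_append, simulate]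
    split_ifs
    · cases o.apply n <;> simp [ih]
    · exact ih n

theorem simulate_map {ι κ : Type*} [DecidableEq ι] [DecidableEq κ] {f : ι → κ}
    (hf : Function.Injective f) (r : ι) (x : List (ι × CounterOp)) (n : ℕ) :
    simulate (f r) (x.map (Prod.map f id)) n = simulate r x n := by
  induction x generalizing n with
  | nil => rfl
  | cons a x ih =>
    obtain ⟨s, o⟩ := a
    simp [simulate, hf.eq_iff, ih]

theorem simulate_of_notMem {ι : Type*} [DecidableEq ι] {r : ι} {x : List (ι × CounterOp)}
    (h : ∀ a ∈ x, a.1 ≠ r) (n : ℕ) : simulate r x n = some n := by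
  induction x with
  | nil => rfl
  | cons a x ih =>
    obtain ⟨s, o⟩ := a
    simp only [simulate, if_neg (h (s, o) (by simp))]
    exact ih fun a ha ↦ h a (by simp [ha])

/-- A relation between register contents is realizable if it is the effect of a regular set of
sequences of operations on finitely many registers. -/
def Realizable (R : (ℕ → ℕ) → (ℕ → ℕ) → Prop) : Prop :=
  ∃ L : Language (ℕ × CounterOp), L.IsRegular ∧ (∃ k, ∀ x ∈ L, ∀ a ∈ x, a.1 < k) ∧
    ∀ v v', R v v' ↔ ∃ x ∈ L, ∀ r, simulate r x (v r) = some (v' r)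

namespace Realizable

variable {R S : (ℕ → ℕ) → (ℕ → ℕ) → Prop}

theorem op (r : ℕ) (o : CounterOp) : Realizable fun v v' ↦
    o.apply (v r) = some (v' r) ∧ ∀ s ≠ r, v' s = v s := by
  refine ⟨{[(r, o)]}, Language.isRegular_singleton_letter _, ⟨r + 1, ?_⟩, fun v v' ↦ ⟨?_, ?_⟩⟩
  · rintro _ rfl a ha
    rw [List.mem_singleton] at ha
    subst ha
    exact Nat.lt_succ_self r
  · rintro ⟨h, h'⟩
    refine ⟨_, rfl, fun s ↦ ?_⟩
    by_cases hs : r = s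
    · subst hs
      simp [simulate, h]
    · simp [simulate, hs, h' s (Ne.symm hs)]
  · rintro ⟨_, rfl, h⟩
    refine ⟨by simpa [simulate] using h r, fun s hs ↦ ?_⟩
    simpa [simulate, Ne.symm hs, eq_comm] using h s

theorem congr (h : Realizable R) (hRS : ∀ v v', R v v' ↔ S v v') : Realizable S := by
  obtain ⟨L, hL, hk, hR⟩ := h
  exact ⟨L, hL, hk, fun v v' ↦ (hRS v v').symm.trans (hR v v')⟩

theorem inc (r : ℕ) : Realizable fun v v' ↦ v' = Function.update v r (v r + 1) := by
  refine (op r .inc).congr fun v v' ↦ ?_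
  rw [Function.eq_update_iff, CounterOp.apply, Option.some.injEq, eq_comm]

theorem dec (r : ℕ) : Realizable fun v v' ↦ v r ≠ 0 ∧ v' = Function.update v r (v r - 1) := by
  refine (op r .dec).congr fun v v' ↦ ?_
  rw [Function.eq_update_iff]
  cases v r <;> simp [CounterOp.apply, eq_comm]

theorem test (r : ℕ) : Realizable fun v v' ↦ v r = 0 ∧ v' = v := by
  refine (op r .test).congr fun v v' ↦ ?_
  constructor
  · rintro ⟨h, h'⟩
    have hr : v r = 0 ∧ v' r = 0 := by
      cases hv : v r <;> simp [hv, CounterOp.apply, eq_comm] at h ⊢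
      exact h
    refine ⟨hr.1, funext fun s ↦ ?_⟩
    by_cases hs : s = r
    · rw [hs, hr.1, hr.2]
    · exact h' s hs
  · rintro ⟨h, rfl⟩
    exact ⟨by rw [h]; rfl, fun _ _ ↦ rfl⟩

theorem comp (hR : Realizable R) (hS : Realizable S) : Realizable (Relation.Comp R S) := by
  obtain ⟨L, hL, ⟨k, hk⟩, hR⟩ := hR
  obtain ⟨L', hL', ⟨k', hk'⟩, hS⟩ := hS
  refine ⟨L * L', hL.mul hL', ⟨max k k', ?_⟩, fun v v' ↦ ⟨?_, ?_⟩⟩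
  · rintro _ ⟨x, hx, y, hy, rfl⟩ a ha
    rcases List.mem_append.1 ha with ha | ha
    exacts [lt_max_of_lt_left (hk x hx a ha), lt_max_of_lt_right (hk' y hy a ha)]
  · rintro ⟨u, h, h'⟩
    obtain ⟨x, hx, hxu⟩ := (hR _ _).1 h
    obtain ⟨y, hy, hyu⟩ := (hS _ _).1 h'
    refine ⟨x ++ y, ⟨x, hx, y, hy, rfl⟩, fun r ↦ ?_⟩
    rw [simulate_append, hxu, Option.bind_some, hyu]
  · rintro ⟨_, ⟨x, hx, y, hy, rfl⟩, h⟩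
    -- The intermediate contents are found separately for each register, since registers do not
    -- interact.
    have h' : ∀ r, ∃ m, simulate r x (v r) = some m ∧ simulate r y m = some (v' r) := fun r ↦ by
      have := h r
      change simulate r (x ++ y) (v r) = _ at this
      rwa [simulate_append, Option.bind_eq_some_iff] at this
    choose u hu hu' using h'
    exact ⟨u, (hR _ _).2 ⟨x, hx, hu⟩, (hS _ _).2 ⟨y, hy, hu'⟩⟩

theorem star (hR : Realizable R) : Realizable (Relation.ReflTransGen R) := by
  obtain ⟨L, hL, ⟨k, hk⟩, hR⟩ := hR
  refine ⟨KStar.kstar L, hL.kstar, ⟨k, ?_⟩, fun v v' ↦ ⟨fun h ↦ ?_, ?_⟩⟩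
  · intro x hx a ha
    obtain ⟨l, rfl, hl⟩ := Language.mem_kstar.1 hx
    obtain ⟨y, hy, hay⟩ := List.mem_flatten.1 ha
    exact hk y (hl y hy) a hay
  · induction h using Relation.ReflTransGen.head_induction_on with
    | refl => exact ⟨[], Language.nil_mem_kstar L, fun r ↦ rfl⟩
    | head h _ ih =>
      obtain ⟨x, hx, hxu⟩ := (hR _ _).1 h
      obtain ⟨y, hy, hyu⟩ := ih
      obtain ⟨l, rfl, hl⟩ := Language.mem_kstar.1 hy
      refine ⟨x ++ l.flatten, Language.mem_kstar.2 ⟨x :: l, rfl, ?_⟩, fun r ↦ ?_⟩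
      · intro w hw
        rcases List.mem_cons.1 hw with rfl | hw
        exacts [hx, hl w hw]
      · rw [simulate_append, hxu, Option.bind_some, hyu]
  · rintro ⟨x, hx, h⟩
    obtain ⟨l, rfl, hl⟩ := Language.mem_kstar.1 hx
    clear hx
    induction l generalizing v with
    | nil =>
      obtain rfl : v = v' := funext fun r ↦ Option.some.inj (h r)
      exact .refl
    | cons x l ih =>
      have h' : ∀ r, ∃ m, simulate r x (v r) = some m ∧
          simulate r l.flatten m = some (v' r) := fun r ↦ by
        have := h r
        rwa [List.flatten_cons, simulate_append, Option.bind_eq_some_iff] at this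
      choose u hu hu' using h'
      exact .head ((hR _ _).2 ⟨x, hl x (by simp), hu⟩)
        (ih u (fun y hy ↦ hl y (by simp [hy])) hu')

/-- This is "while `r` is nonzero, do `R`". The closing zero test excludes iterations that stop too
early, and the decrease of `r` by one per round gives termination. -/
theorem loop (hR : Realizable R) (r : ℕ) (hdec : ∀ v v', R v v' → v r = v' r + 1)
    (hex : ∀ v, v r ≠ 0 → ∃ v', R v v') : ∃ S, Realizable S ∧
      (∀ v v', S v v' → Relation.ReflTransGen R v v' ∧ v' r = 0) ∧ ∀ v, ∃ v', S v v' := by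
  refine ⟨_, hR.star.comp (test r), ?_, fun v ↦ ?_⟩
  · rintro v _ ⟨v', h, h', rfl⟩
    exact ⟨h, h'⟩
  · suffices ∃ v', Relation.ReflTransGen R v v' ∧ v' r = 0 by
      obtain ⟨v', h, h'⟩ := this
      exact ⟨v', v', h, h', rfl⟩
    induction hm : v r generalizing v with
    | zero => exact ⟨v, .refl, hm⟩
    | succ m ih =>
      obtain ⟨u, hu⟩ := hex v (by omega)
      obtain ⟨v', h, h'⟩ := ih u (by have := hdec v u hu; omega)
      exact ⟨v', .head hu h, h'⟩

theorem exists_clear (r : ℕ) : ∃ S, Realizable S ∧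
    (∀ v v', S v v' → v' r = 0 ∧ ∀ q ≠ r, v' q = v q) ∧ ∀ v, ∃ v', S v v' := by
  obtain ⟨S, hS, h, hex⟩ := (dec r).loop r
    (by rintro v _ ⟨hr, rfl⟩; simp; omega) (fun v hv ↦ ⟨_, hv, rfl⟩)
  refine ⟨S, hS, fun v v' hv ↦ ⟨(h v v' hv).2, fun q hq ↦ ?_⟩, hex⟩
  have hp := (h v v' hv).1
  clear hv
  induction hp with
  | refl => rfl
  | tail _ hstep ih =>
    obtain ⟨-, rfl⟩ := hstep
    rw [Function.update_of_ne hq, ih]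

/-- Reading a register destroys it, so `r` is drained into both `s` and `t` and then refilled from
`t`. -/
theorem exists_copy {r s t : ℕ} (hrs : r ≠ s) (hrt : r ≠ t) (hst : s ≠ t) : ∃ S, Realizable S ∧
    (∀ v v', S v v' → v' s = v r ∧ ∀ q, q ≠ s → q ≠ t → v' q = v q) ∧ ∀ v, ∃ v', S v v' := by
  obtain ⟨S₁, hS₁, h₁, hex₁⟩ := exists_clear s
  obtain ⟨S₂, hS₂, h₂, hex₂⟩ := exists_clear t
  have move : ∀ v v', Relation.Comp (fun v v' : ℕ → ℕ ↦ v r ≠ 0 ∧ v' = Function.update v r (v r - 1))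
      (Relation.Comp (fun v v' : ℕ → ℕ ↦ v' = Function.update v s (v s + 1))
        fun v v' : ℕ → ℕ ↦ v' = Function.update v t (v t + 1)) v v' →
      v r = v' r + 1 ∧ v' s = v s + 1 ∧ v' t = v t + 1 ∧
        ∀ q, q ≠ r → q ≠ s → q ≠ t → v' q = v q := by
    rintro v _ ⟨_, ⟨hr, rfl⟩, _, rfl, rfl⟩
    refine ⟨?_, ?_, ?_, fun q h₁ h₂ h₃ ↦ ?_⟩
    · rw [Function.update_of_ne hrt, Function.update_of_ne hrs, Function.update_self]
      omega
    · rw [Function.update_of_ne hst, Function.update_self, Function.update_of_ne hrs.symm]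
    · rw [Function.update_self, Function.update_of_ne hst.symm, Function.update_of_ne hrt.symm]
    · rw [Function.update_of_ne h₃, Function.update_of_ne h₂, Function.update_of_ne h₁]
  obtain ⟨S₃, hS₃, h₃, hex₃⟩ := ((dec r).comp ((inc s).comp (inc t))).loop r
    (fun v v' h ↦ (move v v' h).1) (fun v hv ↦ ⟨_, _, ⟨hv, rfl⟩, _, rfl, rfl⟩)
  have back : ∀ v v', Relation.Comp (fun v v' : ℕ → ℕ ↦ v t ≠ 0 ∧ v' = Function.update v t (v t - 1))
      (fun v v' : ℕ → ℕ ↦ v' = Function.update v r (v r + 1)) v v' →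
      v t = v' t + 1 ∧ v' r = v r + 1 ∧ ∀ q, q ≠ r → q ≠ t → v' q = v q := by
    rintro v _ ⟨_, ⟨hr, rfl⟩, rfl⟩
    refine ⟨?_, ?_, fun q h₁ h₂ ↦ ?_⟩
    · rw [Function.update_of_ne hrt.symm, Function.update_self]
      omega
    · rw [Function.update_self, Function.update_of_ne hrt]
    · rw [Function.update_of_ne h₁, Function.update_of_ne h₂]
  obtain ⟨S₄, hS₄, h₄, hex₄⟩ := ((dec t).comp (inc r)).loop t
    (fun v v' h ↦ (back v v' h).1) (fun v hv ↦ ⟨_, _, ⟨hv, rfl⟩, rfl⟩)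
  have h₃' : ∀ v v', S₃ v v' → v' r = 0 ∧ v' s = v r + v s ∧ v' t = v r + v t ∧
      ∀ q, q ≠ r → q ≠ s → q ≠ t → v' q = v q := by
    intro v v' h
    obtain ⟨hp, h0⟩ := h₃ v v' h
    -- The loop invariants are the sums that each round conserves.
    have : v' r + v' s = v r + v s ∧ v' r + v' t = v r + v t ∧
        ∀ q, q ≠ r → q ≠ s → q ≠ t → v' q = v q := by
      clear h0 h
      induction hp with
      | refl => exact ⟨rfl, rfl, fun _ _ _ _ ↦ rfl⟩
      | tail _ hstep ih =>
        obtain ⟨e₁, e₂, e₃, e₄⟩ := move _ _ hstep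
        obtain ⟨i₁, i₂, i₃⟩ := ih
        exact ⟨by omega, by omega, fun q q₁ q₂ q₃ ↦ (e₄ q q₁ q₂ q₃).trans (i₃ q q₁ q₂ q₃)⟩
    exact ⟨h0, by omega, by omega, this.2.2⟩
  have h₄' : ∀ v v', S₄ v v' → v' r = v r + v t ∧ ∀ q, q ≠ r → q ≠ t → v' q = v q := by
    intro v v' h
    obtain ⟨hp, h0⟩ := h₄ v v' h
    have : v' r + v' t = v r + v t ∧ ∀ q, q ≠ r → q ≠ t → v' q = v q := by
      clear h0 h
      induction hp with
      | refl => exact ⟨rfl, fun _ _ _ ↦ rfl⟩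
      | tail _ hstep ih =>
        obtain ⟨e₁, e₂, e₃⟩ := back _ _ hstep
        obtain ⟨i₁, i₂⟩ := ih
        exact ⟨by omega, fun q q₁ q₂ ↦ (e₃ q q₁ q₂).trans (i₂ q q₁ q₂)⟩
    exact ⟨by omega, this.2⟩
  refine ⟨_, hS₁.comp (hS₂.comp (hS₃.comp hS₄)), ?_, fun v ↦ ?_⟩
  · rintro v v' ⟨v₁, e₁, v₂, e₂, v₃, e₃, e₄⟩
    obtain ⟨a₁, b₁⟩ := h₁ _ _ e₁
    obtain ⟨a₂, b₂⟩ := h₂ _ _ e₂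
    obtain ⟨a₃, b₃, c₃, d₃⟩ := h₃' _ _ e₃
    obtain ⟨a₄, b₄⟩ := h₄' _ _ e₄
    have hr₁ := b₁ r hrs
    have hr₂ := b₂ r hrt
    have hs₂ := b₂ s hst
    have hs₄ := b₄ s hrs.symm hst
    refine ⟨by omega, fun q hqs hqt ↦ ?_⟩
    by_cases hqr : q = r
    · subst hqr
      omega
    · rw [b₄ q hqr hqt, d₃ q hqr hqs hqt, b₂ q hqt, b₁ q hqs]
  · obtain ⟨v₁, e₁⟩ := hex₁ v
    obtain ⟨v₂, e₂⟩ := hex₂ v₁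
    obtain ⟨v₃, e₃⟩ := hex₃ v₂
    obtain ⟨v₄, e₄⟩ := hex₄ v₃
    exact ⟨v₄, v₁, e₁, v₂, e₂, v₃, e₃, e₄⟩

end Realizable

/-! ### Partial recursive functions on registers. -/

/-- A partial function is register computable if, for all choices of input registers below `b`, some
realizable relation writes its value into register `b` and preserves the registers below `b`.
The registers from `b` on are scratch space with arbitrary initial contents. -/
def RegisterComputable {n : ℕ} (f : List.Vector ℕ n →. ℕ) : Prop :=
  ∀ (i : Fin n → ℕ) (b : ℕ), (∀ j, i j < b) → ∃ R, Realizable R ∧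
    (∀ v v', R v v' → v' b ∈ f (List.Vector.ofFn fun j ↦ v (i j)) ∧ ∀ r < b, v' r = v r) ∧
    ∀ v, (f (List.Vector.ofFn fun j ↦ v (i j))).Dom → ∃ v', R v v'

namespace RegisterComputable

theorem zero : RegisterComputable fun _ : List.Vector ℕ 0 ↦ Part.some 0 := by
  intro i b _
  obtain ⟨S, hS, h, hex⟩ := Realizable.exists_clear b
  exact ⟨S, hS, fun v v' hv ↦ ⟨Part.mem_some_iff.2 (h v v' hv).1,
    fun r hr ↦ (h v v' hv).2 r hr.ne⟩, fun v _ ↦ hex v⟩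

theorem get {n : ℕ} (j : Fin n) : RegisterComputable fun v : List.Vector ℕ n ↦
    Part.some (v.get j) := by
  intro i b hb
  have := hb j
  obtain ⟨S, hS, h, hex⟩ := Realizable.exists_copy (r := i j) (s := b) (t := b + 1)
    (by omega) (by omega) (by omega)
  refine ⟨S, hS, fun v v' hv ↦ ⟨?_, fun r hr ↦ (h v v' hv).2 r (by omega) (by omega)⟩,
    fun v _ ↦ hex v⟩
  beta_reduce
  rw [List.Vector.get_ofFn, (h v v' hv).1]
  exact Part.mem_some _

theorem succ : RegisterComputable fun v : List.Vector ℕ 1 ↦ Part.some v.head.succ := by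
  intro i b hb
  have := hb 0
  obtain ⟨S, hS, h, hex⟩ := Realizable.exists_copy (r := i 0) (s := b) (t := b + 1)
    (by omega) (by omega) (by omega)
  refine ⟨_, hS.comp (Realizable.inc b), ?_, fun v _ ↦ ?_⟩
  · rintro v _ ⟨v', hv, rfl⟩
    refine ⟨?_, fun r hr ↦ ?_⟩
    · beta_reduce
      rw [Function.update_self, (h v v' hv).1, List.Vector.head_ofFn]
      exact Part.mem_some _
    · rw [Function.update_of_ne hr.ne, (h v v' hv).2 r (by omega) (by omega)]
  · obtain ⟨v', hv⟩ := hex v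
    exact ⟨_, v', hv, rfl⟩

/-- The `j`-th function runs with base `b + j`, which protects both the inputs and the values
already computed. -/
theorem sequence {m n : ℕ} {g : Fin n → List.Vector ℕ m →. ℕ}
    (hg : ∀ j, RegisterComputable (g j)) (i : Fin m → ℕ) (b : ℕ) (hb : ∀ j, i j < b)
    (l : ℕ) (hl : l ≤ n) : ∃ R, Realizable R ∧
      (∀ v v', R v v' → (∀ j : Fin n, j.1 < l →
        v' (b + j) ∈ g j (List.Vector.ofFn fun j ↦ v (i j))) ∧ ∀ r < b, v' r = v r) ∧
      ∀ v, (∀ j : Fin n, j.1 < l → (g j (List.Vector.ofFn fun j ↦ v (i j))).Dom) →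
        ∃ v', R v v' := by
  induction l with
  | zero =>
    -- Nothing has to be computed; clearing a scratch register is just some total relation that
    -- preserves the inputs.
    obtain ⟨S, hS, h, hex⟩ := Realizable.exists_clear b
    exact ⟨S, hS, fun v v' hv ↦ ⟨fun j hj ↦ absurd hj (Nat.not_lt_zero _),
      fun r hr ↦ (h v v' hv).2 r hr.ne⟩, fun v _ ↦ hex v⟩
  | succ l ih =>
    obtain ⟨R, hR, h, hex⟩ := ih (by omega)
    obtain ⟨S, hS, h', hex'⟩ := hg ⟨l, hl⟩ i (b + l) fun j ↦ (hb j).trans_le (by omega)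
    have hin : ∀ v v', R v v' → (fun j ↦ v' (i j)) = fun j ↦ v (i j) := fun v v' hv ↦
      funext fun j ↦ (h v v' hv).2 _ (hb j)
    refine ⟨_, hR.comp hS, ?_, fun v hv ↦ ?_⟩
    · rintro v v' ⟨u, hu, hv⟩
      obtain ⟨e₁, e₂⟩ := h _ _ hu
      obtain ⟨e₃, e₄⟩ := h' _ _ hv
      refine ⟨fun j hj ↦ ?_, fun r hr ↦ by rw [e₄ r (by omega), e₂ r hr]⟩
      rcases Nat.lt_succ_iff_lt_or_eq.1 hj with hj | hj
      · rw [e₄ _ (by omega)]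
        exact e₁ j hj
      · obtain rfl : j = ⟨l, hl⟩ := Fin.ext hj
        rwa [hin v u hu] at e₃
    · obtain ⟨u, hu⟩ := hex v fun j hj ↦ hv j (by omega)
      obtain ⟨v', hv'⟩ := hex' u (by rw [hin v u hu]; exact hv _ (Nat.lt_succ_self l))
      exact ⟨v', u, hu, hv'⟩

/-- Describing `F` by its graph lets one proof serve total and partial composition. -/
theorem comp {m n : ℕ} {g : Fin n → List.Vector ℕ m →. ℕ} {f : List.Vector ℕ n →. ℕ}
    {F : List.Vector ℕ m →. ℕ} (hf : RegisterComputable f) (hg : ∀ j, RegisterComputable (g j))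
    (hF : ∀ v y, y ∈ F v ↔ ∃ w : List.Vector ℕ n, (∀ j, w.get j ∈ g j v) ∧ y ∈ f w) :
    RegisterComputable F := by
  intro i b hb
  obtain ⟨R, hR, h, hex⟩ := sequence hg i b hb n le_rfl
  obtain ⟨S, hS, h', hex'⟩ := hf (fun j ↦ b + j) (b + n) fun j ↦ by omega
  -- The result goes from `b + n` to `b` by way of `b + n + 1`, because for `n = 0` source and
  -- target coincide and a direct copy is not available.
  obtain ⟨C, hC, hc, hexc⟩ := Realizable.exists_copy (r := b + n) (s := b + n + 1)
    (t := b + n + 2) (by omega) (by omega) (by omega)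
  obtain ⟨C', hC', hc', hexc'⟩ := Realizable.exists_copy (r := b + n + 1) (s := b)
    (t := b + n + 2) (by omega) (by omega) (by omega)
  refine ⟨_, hR.comp (hS.comp (hC.comp hC')), ?_, fun v hv ↦ ?_⟩
  · rintro v v' ⟨v₁, e₁, v₂, e₂, v₃, e₃, e₄⟩
    obtain ⟨a₁, b₁⟩ := h _ _ e₁
    obtain ⟨a₂, b₂⟩ := h' _ _ e₂
    obtain ⟨a₃, b₃⟩ := hc _ _ e₃
    obtain ⟨a₄, b₄⟩ := hc' _ _ e₄
    refine ⟨?_, fun r hr ↦ ?_⟩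
    · rw [a₄, a₃, hF]
      exact ⟨_, fun j ↦ by rw [List.Vector.get_ofFn]; exact a₁ j j.2, a₂⟩
    · rw [b₄ r (by omega) (by omega), b₃ r (by omega) (by omega), b₂ r (by omega), b₁ r hr]
  · obtain ⟨w, hw, hy⟩ := (hF _ _).1 (Part.get_mem hv)
    obtain ⟨v₁, e₁⟩ := hex v fun j _ ↦ Part.dom_iff_mem.2 ⟨_, hw j⟩
    have hw' : (List.Vector.ofFn fun j : Fin n ↦ v₁ (b + j)) = w := List.Vector.ext fun j ↦ by
      rw [List.Vector.get_ofFn]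
      exact Part.mem_unique ((h _ _ e₁).1 j j.2) (hw j)
    obtain ⟨v₂, e₂⟩ := hex' v₁ (by rw [hw']; exact Part.dom_iff_mem.2 ⟨_, hy⟩)
    obtain ⟨v₃, e₃⟩ := hexc v₂
    obtain ⟨v₄, e₄⟩ := hexc' v₃
    exact ⟨v₄, v₁, e₁, v₂, e₂, v₃, e₃, e₄⟩

/-- Register `b` accumulates the value, `b + 1` is the recursion index, `b + 2` counts the remaining
rounds, and `b + 3` receives the value of `g`. Invariant: index plus remaining rounds is the
argument, and `b` holds the recursion value at the index. -/
theorem prec {n : ℕ} {f : List.Vector ℕ n → ℕ} {g : List.Vector ℕ (n + 2) → ℕ}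
    (hf : RegisterComputable fun v ↦ Part.some (f v))
    (hg : RegisterComputable fun v ↦ Part.some (g v)) :
    RegisterComputable fun v : List.Vector ℕ (n + 1) ↦
      Part.some (v.head.rec (f v.tail) fun y IH ↦ g (y ::ᵥ IH ::ᵥ v.tail)) := by
  intro i b hb
  have hb0 := hb 0
  obtain ⟨F, hF, hf, hexf⟩ := hf (fun j ↦ i j.succ) b fun j ↦ hb _
  obtain ⟨C, hC, hc, hexc⟩ := Realizable.exists_clear (b + 1)
  obtain ⟨D, hD, hd, hexd⟩ := Realizable.exists_copy (r := i 0) (s := b + 2) (t := b + 3)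
    (by omega) (by omega) (by omega)
  obtain ⟨G, hG, hg, hexg⟩ := hg (Fin.cons (b + 1) (Fin.cons b fun j ↦ i j.succ)) (b + 3) (by
    intro j
    refine Fin.cases ?_ (fun j ↦ Fin.cases ?_ (fun j ↦ ?_) j) j
    · simp
    · simp
    · simpa using (hb j.succ).trans_le (by omega))
  obtain ⟨E, hE, he, hexe⟩ := Realizable.exists_copy (r := b + 3) (s := b) (t := b + 4)
    (by omega) (by omega) (by omega)
  have body := (Realizable.dec (b + 2)).comp (hG.comp (hE.comp (Realizable.inc (b + 1))))
  have step : ∀ v v', Relation.Comp (fun v v' : ℕ → ℕ ↦ v (b + 2) ≠ 0 ∧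
      v' = Function.update v (b + 2) (v (b + 2) - 1)) (Relation.Comp G (Relation.Comp E
        fun v v' : ℕ → ℕ ↦ v' = Function.update v (b + 1) (v (b + 1) + 1))) v v' →
      v (b + 2) = v' (b + 2) + 1 ∧ v' (b + 1) = v (b + 1) + 1 ∧
      v' b = g (v (b + 1) ::ᵥ v b ::ᵥ List.Vector.ofFn fun j : Fin n ↦ v (i j.succ)) ∧
      ∀ r < b, v' r = v r := by
    rintro v _ ⟨_, ⟨h0, rfl⟩, v₂, e₂, v₃, e₃, rfl⟩
    obtain ⟨a₂, b₂⟩ := hg _ _ e₂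
    obtain ⟨a₃, b₃⟩ := he _ _ e₃
    have low : ∀ r < b, Function.update v (b + 2) (v (b + 2) - 1) r = v r := fun r hr ↦
      Function.update_of_ne (by omega) _ _
    refine ⟨?_, ?_, ?_, fun r hr ↦ ?_⟩
    · rw [Function.update_of_ne (by omega), b₃ _ (by omega) (by omega), b₂ _ (by omega),
        Function.update_self]
      omega
    · rw [Function.update_self, b₃ _ (by omega) (by omega), b₂ _ (by omega),
        Function.update_of_ne (by omega)]
    · rw [Function.update_of_ne (by omega), a₃, Part.mem_some_iff.1 a₂]
      simp only [List.Vector.ofFn, Fin.cons_zero, Fin.cons_succ]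
      rw [Function.update_of_ne (by omega), Function.update_of_ne (by omega)]
      simp only [low _ (hb _)]
    · rw [Function.update_of_ne (by omega), b₃ _ (by omega) (by omega), b₂ _ (by omega), low r hr]
  obtain ⟨S, hS, hs, hexs⟩ := body.loop (b + 2) (fun v v' h ↦ (step v v' h).1) fun v hv ↦ by
    obtain ⟨v₂, e₂⟩ := hexg (Function.update v (b + 2) (v (b + 2) - 1)) trivial
    obtain ⟨v₃, e₃⟩ := hexe v₂
    exact ⟨_, _, ⟨hv, rfl⟩, v₂, e₂, v₃, e₃, rfl⟩
  refine ⟨_, hF.comp (hC.comp (hD.comp hS)), ?_, fun v _ ↦ ?_⟩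
  · rintro v v' ⟨v₁, e₁, v₂, e₂, v₃, e₃, e₄⟩
    obtain ⟨a₁, b₁⟩ := hf _ _ e₁
    obtain ⟨a₂, b₂⟩ := hc _ _ e₂
    obtain ⟨a₃, b₃⟩ := hd _ _ e₃
    obtain ⟨a₄, b₄⟩ := hs _ _ e₄
    have low : ∀ r < b, v₃ r = v r := fun r hr ↦ by
      rw [b₃ r (by omega) (by omega), b₂ r (by omega), b₁ r hr]
    rw [b₂ _ (by omega), b₁ _ hb0] at a₃
    have acc : v₃ b = f (List.Vector.ofFn fun j ↦ v (i j.succ)) := by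
      rw [b₃ b (by omega) (by omega), b₂ b (by omega), Part.mem_some_iff.1 a₁]
    have idx : v₃ (b + 1) = 0 := by rw [b₃ _ (by omega) (by omega), a₂]
    have inv : v' (b + 1) + v' (b + 2) = v (i 0) ∧ v' b = Nat.rec
        (f (List.Vector.ofFn fun j ↦ v (i j.succ)))
        (fun y IH ↦ g (y ::ᵥ IH ::ᵥ List.Vector.ofFn fun j ↦ v (i j.succ))) (v' (b + 1)) ∧
        ∀ r < b, v' r = v r := by
      clear e₄ b₄
      induction a₄ with
      | refl => exact ⟨by omega, by rw [idx]; exact acc, low⟩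
      | tail _ hstep ih =>
        obtain ⟨i₁, i₂, i₃⟩ := ih
        obtain ⟨s₁, s₂, s₃, s₄⟩ := step _ _ hstep
        refine ⟨by omega, ?_, fun r hr ↦ (s₄ r hr).trans (i₃ r hr)⟩
        rw [s₂, s₃, i₂]
        simp only [i₃ _ (hb _)]
    obtain ⟨i₁, i₂, i₃⟩ := inv
    refine ⟨?_, i₃⟩
    rw [b₄, Nat.add_zero] at i₁
    rw [i₁] at i₂
    beta_reduce
    rw [i₂, List.Vector.head_ofFn, List.Vector.tail_ofFn]
    exact Part.mem_some _
  · obtain ⟨v₁, e₁⟩ := hexf v trivial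
    obtain ⟨v₂, e₂⟩ := hexc v₁
    obtain ⟨v₃, e₃⟩ := hexd v₂
    obtain ⟨v₄, e₄⟩ := hexs v₃
    exact ⟨v₄, v₁, e₁, v₂, e₂, v₃, e₃, e₄⟩

/-- Register `b` holds the candidate and `b + 1` the value of `f` there. In the loop body the
decrement of `b + 1` serves only as a test for a nonzero value; the final zero test certifies the
root, and the invariant that smaller candidates fail makes it the least one. -/
theorem rfind {n : ℕ} {f : List.Vector ℕ (n + 1) → ℕ}
    (hf : RegisterComputable fun v ↦ Part.some (f v)) :
    RegisterComputable fun v ↦ Nat.rfind fun y ↦ Part.some (f (y ::ᵥ v) = 0) := by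
  intro i b hb
  obtain ⟨C, hC, hc, hexc⟩ := Realizable.exists_clear b
  obtain ⟨F, hF, hf, hexf⟩ := hf (Fin.cons b i) (b + 1) (by
    intro j
    refine Fin.cases ?_ (fun j ↦ ?_) j
    · simp
    · simpa using (hb j).le)
  have hf' : ∀ v v', F v v' →
      v' (b + 1) = f (v b ::ᵥ List.Vector.ofFn fun j ↦ v (i j)) ∧ ∀ r ≤ b, v' r = v r := by
    intro v v' h
    obtain ⟨h₁, h₂⟩ := hf v v' h
    refine ⟨?_, fun r hr ↦ h₂ r (by omega)⟩
    rw [Part.mem_some_iff.1 h₁]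
    simp only [List.Vector.ofFn, Fin.cons_zero, Fin.cons_succ]
  have body := hF.comp ((Realizable.dec (b + 1)).comp (Realizable.inc b))
  have step : ∀ v v', Relation.Comp F (Relation.Comp (fun v v' : ℕ → ℕ ↦ v (b + 1) ≠ 0 ∧
      v' = Function.update v (b + 1) (v (b + 1) - 1))
        fun v v' : ℕ → ℕ ↦ v' = Function.update v b (v b + 1)) v v' →
      f (v b ::ᵥ List.Vector.ofFn fun j ↦ v (i j)) ≠ 0 ∧ v' b = v b + 1 ∧
        ∀ r < b, v' r = v r := by
    rintro v _ ⟨v₁, e₁, _, ⟨h0, rfl⟩, rfl⟩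
    obtain ⟨a₁, b₁⟩ := hf' _ _ e₁
    refine ⟨a₁ ▸ h0, ?_, fun r hr ↦ ?_⟩
    · rw [Function.update_self, Function.update_of_ne (by omega), b₁ b le_rfl]
    · rw [Function.update_of_ne (by omega), Function.update_of_ne (by omega), b₁ r hr.le]
  refine ⟨_, hC.comp (body.star.comp (hF.comp (Realizable.test (b + 1)))), ?_, fun v hv ↦ ?_⟩
  · rintro v _ ⟨v₁, e₁, v₂, e₂, v', e₃, h0, rfl⟩
    obtain ⟨a₁, b₁⟩ := hc _ _ e₁
    obtain ⟨a₃, b₃⟩ := hf' _ _ e₃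
    have inv : (∀ y < v₂ b, f (y ::ᵥ List.Vector.ofFn fun j ↦ v (i j)) ≠ 0) ∧
        ∀ r < b, v₂ r = v r := by
      clear e₃ a₃ b₃
      induction e₂ with
      | refl => exact ⟨fun y hy ↦ by omega, fun r hr ↦ b₁ r hr.ne⟩
      | tail _ hstep ih =>
        obtain ⟨i₁, i₂⟩ := ih
        obtain ⟨s₁, s₂, s₃⟩ := step _ _ hstep
        simp only [i₂ _ (hb _)] at s₁
        refine ⟨fun y hy ↦ ?_, fun r hr ↦ (s₃ r hr).trans (i₂ r hr)⟩
        rcases Nat.lt_succ_iff_lt_or_eq.1 (s₂ ▸ hy) with hy | rfl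
        exacts [i₁ y hy, s₁]
    obtain ⟨i₁, i₂⟩ := inv
    simp only [i₂ _ (hb _)] at a₃
    refine ⟨Nat.mem_rfind.2 ⟨?_, fun {y} hy ↦ ?_⟩, fun r hr ↦ (b₃ r hr.le).trans (i₂ r hr)⟩
    · rw [b₃ b le_rfl]
      simpa using a₃.symm.trans h0
    · rw [b₃ b le_rfl] at hy
      simpa using i₁ y hy
  · obtain ⟨hy, hlt⟩ := Nat.mem_rfind.1 (Part.get_mem hv)
    generalize (Nat.rfind _).get hv = y at hy hlt
    have hy' : f (y ::ᵥ List.Vector.ofFn fun j ↦ v (i j)) = 0 := by simpa using hy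
    have hlt' : ∀ z < y, f (z ::ᵥ List.Vector.ofFn fun j ↦ v (i j)) ≠ 0 := fun z hz ↦ by
      simpa using hlt hz
    obtain ⟨v₁, e₁⟩ := hexc v
    obtain ⟨a₁, b₁⟩ := hc _ _ e₁
    have key : ∀ z ≤ y, ∃ u, Relation.ReflTransGen (Relation.Comp F (Relation.Comp
        (fun v v' ↦ v (b + 1) ≠ 0 ∧ v' = Function.update v (b + 1) (v (b + 1) - 1))
          fun v v' : ℕ → ℕ ↦ v' = Function.update v b (v b + 1))) v₁ u ∧ u b = z ∧
            ∀ r < b, u r = v r := by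
      intro z hz
      induction z with
      | zero => exact ⟨v₁, .refl, a₁, fun r hr ↦ b₁ r hr.ne⟩
      | succ z ih =>
        obtain ⟨u, hu, rfl, hlow⟩ := ih (by omega)
        obtain ⟨w, hw⟩ := hexf u trivial
        have hne : w (b + 1) ≠ 0 := by
          rw [(hf' _ _ hw).1]
          simp only [hlow _ (hb _)]
          exact hlt' _ hz
        have hs := (⟨w, hw, _, ⟨hne, rfl⟩, rfl⟩ : Relation.Comp F (Relation.Comp
          (fun v v' ↦ v (b + 1) ≠ 0 ∧ v' = Function.update v (b + 1) (v (b + 1) - 1))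
            fun v v' : ℕ → ℕ ↦ v' = Function.update v b (v b + 1)) u _)
        obtain ⟨-, s₂, s₃⟩ := step _ _ hs
        exact ⟨_, hu.tail hs, s₂, fun r hr ↦ (s₃ r hr).trans (hlow r hr)⟩
    obtain ⟨u, hu, rfl, hlow⟩ := key y le_rfl
    obtain ⟨w, hw⟩ := hexf u trivial
    refine ⟨w, v₁, e₁, u, hu, w, hw, ?_, rfl⟩
    rw [(hf' _ _ hw).1]
    simp only [hlow _ (hb _)]
    exact hy'

theorem of_primrec {n : ℕ} {f : List.Vector ℕ n → ℕ} (hf : Nat.Primrec' f) :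
    RegisterComputable fun v ↦ Part.some (f v) := by
  induction hf with
  | zero => exact zero
  | succ => exact succ
  | get j => exact get j
  | comp g _ _ ihf ihg =>
    refine comp ihf ihg fun v y ↦ ?_
    simp only [Part.mem_some_iff]
    constructor
    · rintro rfl
      exact ⟨_, fun j ↦ List.Vector.get_ofFn _ j, rfl⟩
    · rintro ⟨w, hw, rfl⟩
      congr 1
      exact List.Vector.ext fun j ↦ by rw [hw, List.Vector.get_ofFn]
  | prec _ _ ihf ihg => exact prec ihf ihg

theorem mem_mOfFn {n : ℕ} {g : Fin n → Part ℕ} {w : List.Vector ℕ n} :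
    w ∈ List.Vector.mOfFn g ↔ ∀ j, w.get j ∈ g j := by
  induction n with
  | zero =>
    simp only [List.Vector.mOfFn, IsEmpty.forall_iff, iff_true]
    exact Part.mem_some_iff.2 (Subsingleton.elim _ _)
  | succ n ih =>
    simp only [List.Vector.mOfFn, Part.bind_eq_bind, Part.mem_bind_iff, Fin.forall_fin_succ, ih]
    constructor
    · rintro ⟨a, ha, x, hx, hw⟩
      obtain rfl := Part.mem_some_iff.1 hw
      exact ⟨ha, fun j ↦ by simpa using hx j⟩
    · rintro ⟨h0, h⟩
      exact ⟨_, h0, w.tail, fun j ↦ by simpa using h j, Part.mem_some_iff.2 (by simp)⟩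

theorem of_partrec {n : ℕ} {f : List.Vector ℕ n →. ℕ} (hf : Nat.Partrec' f) :
    RegisterComputable f := by
  induction hf with
  | prim hf => exact of_primrec hf
  | @comp m n f g _ _ ihf ihg =>
    refine comp ihf ihg fun v y ↦ ?_
    exact Part.mem_bind_iff.trans (exists_congr fun w ↦ and_congr_left' mem_mOfFn)
  | rfind _ ih => exact rfind ih

end RegisterComputable

/-! ### Relabelling letters, and codes depending on a parameter. -/

section Relabel

variable {α β Q : Type*} {T : Set (Q × Option α × Bool × ℕ × Q)} {p q : Q} {n m : ℕ} {w : List α}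

/-- Apply a map to the letter of a transition. -/
def mapLetter (f : α → β) (t : Q × Option α × Bool × ℕ × Q) : Q × Option β × Bool × ℕ × Q :=
  (t.1, t.2.1.map f, t.2.2)

theorem CounterPath.mapLetter (f : α → β) (h : CounterPath T p n w q m) :
    CounterPath (mapLetter f '' T) p n (w.map f) q m := by
  have letter (a : Option α) : a.toList.map f = (a.map f).toList := by cases a <;> rfl
  induction h with
  | refl => exact .refl _ _
  | head hm _ ih =>
    rw [List.map_append]
    refine .head ?_ ih
    cases hm with
    | empty h => rw [letter]; exact .empty ⟨_, h, rfl⟩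
    | nonempty h => rw [letter]; exact .nonempty ⟨_, h, rfl⟩

theorem IsCounterRel.relabel {R : ℕ → List α → ℕ → Prop} (hR : IsCounterRel R) (e : α ≃ β) :
    IsCounterRel fun n (w : List β) m ↦ R n (w.map e.symm) m := by
  obtain ⟨Q, hQ, T, hT, s, f, h⟩ := hR
  refine ⟨Q, hQ, _root_.mapLetter e '' T, hT.image _, s, f, fun n w m ↦ ⟨fun hp ↦ ?_, fun hr ↦ ?_⟩⟩
  · have hp' := hp.mapLetter e.symm
    rw [← Set.image_comp] at hp'
    have hid : _root_.mapLetter (Q := Q) e.symm ∘ _root_.mapLetter e = id := by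
      funext t
      simp [_root_.mapLetter]
    rw [hid, Set.image_id] at hp'
    exact (h _ _ _).1 hp'
  · simpa using ((h _ _ _).2 hr).mapLetter e

end Relabel

/-- The automaton with an initial transition that sets the counter to `n` has a code that depends
computably on `n`. -/
theorem IsCounterRel.exists_computable_code {k : ℕ} {R : ℕ → List (Fin k) → ℕ → Prop}
    (hR : IsCounterRel R) : ∃ c : ℕ → CounterCode, Computable c ∧
      ∀ n w, w ∈ ((c n).toAutomaton k).language ↔ ∃ m, R n w m := by
  obtain ⟨Q, _, T, hT, s, f, h⟩ := hR
  obtain ⟨N, ⟨e⟩⟩ := Finite.exists_equiv_fin Q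
  -- The shift frees state 0 for the transition that loads `n`; no transition leads back to it.
  let E : Q → Fin (N + 1) := fun q ↦ (e q).succ
  have hE : Function.Injective E := (Fin.succ_injective N).comp e.injective
  let L := hT.toFinset.toList.map fun t ↦ transNumbers (mapTransition E t)
  refine ⟨fun n ↦ (N, [(E f).val], (0, none, true, n, (E s).val) :: L), ?_, fun n w ↦ ?_⟩
  · exact ((Primrec.const N).pair ((Primrec.const [(E f).val]).pair
      (Primrec.list_cons.comp ((Primrec.const 0).pair ((Primrec.const none).pair
        ((Primrec.const true).pair (Primrec.id.pair (Primrec.const (E s).val)))))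
          (Primrec.const L)))).to_comp
  have htrans : (CounterCode.toAutomaton k
      (N, [(E f).val], (0, none, true, n, (E s).val) :: L)).trans =
      {((0 : Fin (N + 1)), none, true, n, E s)} ∪ mapTransition E '' T := by
    ext t
    simp only [CounterCode.toAutomaton, L, Set.mem_ofPred_eq, List.mem_cons, List.mem_map,
      Finset.mem_toList, Set.Finite.mem_toFinset, transNumbers_injective.eq_iff,
      Set.mem_union, Set.mem_singleton_iff, Set.mem_image]
    refine or_congr ?_ Iff.rfl
    exact transNumbers_injective.eq_iff (b := ((0 : Fin (N + 1)), none, true, n, E s))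
  have hlang : w ∈ (CounterCode.toAutomaton k
      (N, [(E f).val], (0, none, true, n, (E s).val) :: L)).language ↔
      ∃ m, CounterPath ({((0 : Fin (N + 1)), none, true, n, E s)} ∪ mapTransition E '' T)
        0 0 w (E f) m := by
    rw [← htrans]
    constructor
    · rintro ⟨q, hq, m, hr⟩
      obtain rfl : q = E f := Fin.ext (List.mem_singleton.1 hq)
      exact ⟨m, (OneCounterAutomaton.run_iff_counterPath _).1 hr⟩
    · rintro ⟨m, hr⟩
      exact ⟨E f, List.mem_singleton.2 rfl, m, (OneCounterAutomaton.run_iff_counterPath _).2 hr⟩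
  rw [hlang]
  refine exists_congr fun m ↦ ?_
  rw [← h]
  constructor
  · intro hp
    have key : ∀ P i w P' m, CounterPath ({((0 : Fin (N + 1)), none, true, n, E s)} ∪
        mapTransition E '' T) P i w P' m → P' = E f →
          (∀ p, P = E p → CounterPath T p i w f m) ∧ (P = 0 → CounterPath T s n w f m) := by
      intro P i w P' m hp
      induction hp with
      | refl P i =>
        rintro rfl
        refine ⟨fun p hp ↦ ?_, fun h0 ↦ absurd h0 (Fin.succ_ne_zero _)⟩
        obtain rfl := hE hp
        exact .refl _ _
      | head hm _ ih =>
        intro hP'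
        obtain ⟨ih', -⟩ := ih hP'
        rw [counterMove_union, counterMove_singleton, counterMove_image] at hm
        rcases hm with ⟨rfl, rfl, rfl, ⟨-, rfl, rfl⟩ | ⟨⟨⟩, -⟩⟩ | ⟨p, q, rfl, rfl, hm⟩
        · exact ⟨fun p hp ↦ absurd hp.symm (Fin.succ_ne_zero _), fun _ ↦ ih' s rfl⟩
        · refine ⟨fun p' hp ↦ ?_, fun h0 ↦ absurd h0 (Fin.succ_ne_zero _)⟩
          obtain rfl := hE hp
          exact .head hm (ih' q rfl)
    exact (key _ _ _ _ _ hp rfl).2 rfl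
  · intro hp
    exact .head (u := []) (.empty (a := none) (.inl rfl)) (hp.map fun t ht ↦ .inr ht)

/-! ### Detecting inapplicable sequences of operations with one counter. -/

section Errors

variable {ι : Type} [DecidableEq ι]

theorem simulate_eq_none_iff (r : ι) (x : List (ι × CounterOp)) (n : ℕ) :
    simulate r x n = none ↔ ∃ x₁ a x₂ m, x = x₁ ++ a :: x₂ ∧ simulate r x₁ n = some m ∧
      ((a = (r, .dec) ∧ m = 0) ∨ (a = (r, .test) ∧ m ≠ 0)) := by
  constructor
  · intro h
    induction x generalizing n with
    | nil => cases h
    | cons a x ih =>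
      by_cases ha : (a = (r, .dec) ∧ n = 0) ∨ (a = (r, .test) ∧ n ≠ 0)
      · exact ⟨[], a, x, n, rfl, rfl, ha⟩
      · obtain ⟨m, hm⟩ : ∃ m, simulate r [a] n = some m := by
          obtain ⟨s, o⟩ := a
          by_cases hs : s = r
          · subst hs
            rcases o <;> rcases n <;> simp_all [simulate, CounterOp.apply]
          · exact ⟨n, by simp [simulate, hs]⟩
        rw [← List.singleton_append, simulate_append, hm, Option.bind_some] at h
        obtain ⟨x₁, b, x₂, l, rfl, h₁, h₂⟩ := ih m h
        refine ⟨a :: x₁, b, x₂, l, rfl, ?_, h₂⟩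
        rw [← List.singleton_append, simulate_append, hm, Option.bind_some, h₁]
  · rintro ⟨x₁, a, x₂, m, rfl, h₁, h₂⟩
    rw [simulate_append, h₁, Option.bind_some]
    rcases h₂ with ⟨rfl, rfl⟩ | ⟨rfl, hm⟩
    · simp [simulate, CounterOp.apply]
    · obtain ⟨m, rfl⟩ := Nat.exists_eq_succ_of_ne_zero hm
      simp [simulate, CounterOp.apply]

theorem isCounterRel_simulate [Finite ι] (r : ι) :
    IsCounterRel fun n (w : List (Option (ι × CounterOp))) m ↦
      ∃ x : List (ι × CounterOp), w = x.map some ∧ simulate r x n = some m := by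
  have step (a : ι × CounterOp) : IsCounterRel fun n (w : List (Option (ι × CounterOp))) m ↦
      w = [some a] ∧ simulate r [a] n = some m := by
    obtain ⟨s, o⟩ := a
    by_cases hs : s = r
    · subst hs
      rcases o
      · refine (IsCounterRel.add (some (some (s, .inc))) 1).congr fun n w m ↦ ?_
        simp [simulate, CounterOp.apply, eq_comm]
      · refine (IsCounterRel.sub (some (some (s, .dec))) 1).congr fun n w m ↦ ?_
        rcases n <;> simp [simulate, CounterOp.apply]
      · refine (IsCounterRel.move (some (some (s, .test))) true 0).congr fun n w m ↦ ?_
        rcases n <;> simp [simulate, CounterOp.apply, eq_comm]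
    · refine (IsCounterRel.add (some (some (s, o))) 0).congr fun n w m ↦ ?_
      simp [simulate, hs, eq_comm]
  refine (IsCounterRel.iUnion step).star.congr fun n w m ↦ ⟨fun h ↦ ?_, ?_⟩
  · induction h with
    | nil n => exact ⟨[], rfl, rfl⟩
    | cons h _ ih =>
      obtain ⟨a, rfl, h⟩ := h
      obtain ⟨x, rfl, hx⟩ := ih
      refine ⟨a :: x, rfl, ?_⟩
      rw [← List.singleton_append, simulate_append, h, Option.bind_some, hx]
  · rintro ⟨x, rfl, h⟩
    induction x generalizing n with
    | nil =>
      obtain rfl := Option.some.inj h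
      exact .nil _
    | cons a x ih =>
      rw [← List.singleton_append, simulate_append, Option.bind_eq_some_iff] at h
      obtain ⟨l, hl, hx⟩ := h
      exact .cons (u := [some a]) ⟨a, rfl, hl⟩ (ih _ hx)

/-- The automaton simulates register `r` up to a guessed failure, then reads a decrement on the
empty stack or a zero test on a nonempty one; the remaining letters are arbitrary. -/
theorem exists_isCounterRel_simulate_eq_none [Finite ι] (r : ι) :
    ∃ R : ℕ → List (Option (ι × CounterOp)) → ℕ → Prop, IsCounterRel R ∧
      ∀ n w, (∃ m, R n w m) ↔
        ∃ x : List (ι × CounterOp), w = x.map some ∧ simulate r x n = none := by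
  refine ⟨_, (isCounterRel_simulate r).seq
    (((IsCounterRel.move (some (some (r, .dec))) true 0).or
      (IsCounterRel.move (some (some (r, .test))) false 0)).seq isCounterRel_letters),
    fun n w ↦ ?_⟩
  refine Iff.trans ?_ (exists_congr fun x ↦ and_congr_right fun _ ↦
    (simulate_eq_none_iff r x n).symm)
  constructor
  · rintro ⟨m, _, _, l, rfl, ⟨x₁, rfl, h₁⟩, _, _, l', rfl, h, ⟨x₂, rfl⟩, rfl⟩
    rcases h with ⟨rfl, ⟨-, h0, -⟩ | ⟨⟨⟩, -⟩⟩ | ⟨rfl, ⟨⟨⟩, -⟩ | ⟨-, i, hi, -⟩⟩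
    · exact ⟨x₁ ++ (r, .dec) :: x₂, by simp, x₁, _, x₂, l, rfl, h₁, .inl ⟨rfl, h0⟩⟩
    · exact ⟨x₁ ++ (r, .test) :: x₂, by simp, x₁, _, x₂, l, rfl, h₁, .inr ⟨rfl, by omega⟩⟩
  · rintro ⟨_, rfl, x₁, a, x₂, m, rfl, h₁, h₂⟩
    rcases h₂ with ⟨rfl, rfl⟩ | ⟨rfl, hm⟩
    · exact ⟨0, _, _, _, List.map_append, ⟨x₁, rfl, h₁⟩, [some (r, .dec)], x₂.map some, 0, rfl,
        .inl ⟨rfl, .inl ⟨rfl, rfl, rfl⟩⟩, ⟨x₂, rfl⟩, rfl⟩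
    · obtain ⟨i, rfl⟩ := Nat.exists_eq_succ_of_ne_zero hm
      exact ⟨i, _, _, _, List.map_append, ⟨x₁, rfl, h₁⟩, [some (r, .test)], x₂.map some, i, rfl,
        .inr ⟨rfl, .inr ⟨rfl, i, rfl, rfl⟩⟩, ⟨x₂, rfl⟩, rfl⟩

/-- Inclusion of all squares expresses that no word of `L` is a sequence of operations that is
applicable when all registers start with the value `n`. -/
theorem exists_isCounterRel_squares_iff [Finite ι] {L : Language (ι × CounterOp)}
    (hL : L.IsRegular) : ∃ R : ℕ → List (Option (ι × CounterOp)) → ℕ → Prop, IsCounterRel R ∧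
      ∀ n, (∀ w, ∃ m, R n (w ++ w) m) ↔ ¬ ∃ x ∈ L, ∀ r, simulate r x n ≠ none := by
  choose E hE hE' using fun r : ι ↦ exists_isCounterRel_simulate_eq_none r
  have hbad := (IsCounterRel.of_isRegular hL.compl.image_some).or (IsCounterRel.iUnion hE)
  refine ⟨_, isCounterRel_letters.or (hbad.seq
    ((IsCounterRel.add (some (none : Option (ι × CounterOp))) 0).seq
      (IsCounterRel.of_isRegular Language.isRegular_top))), fun n ↦ ⟨?_, ?_⟩⟩
  · rintro h ⟨x, hx, hv⟩
    -- Test the square x#x#: it contains #, and the part before its first # can only be `x`, which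
    -- is in `L` and fails on no register.
    obtain ⟨m, ⟨⟨y, hy⟩, -⟩ | ⟨_, _, l, hw, hb, _, z, l', rfl, ⟨rfl, -⟩, -⟩⟩ :=
      h (x.map some ++ [none])
    · have : none ∈ y.map some := hy ▸ by simp
      simp at this
    · have hw' : ∀ y : List (ι × CounterOp), x.map some ++ [none] ++ (x.map some ++ [none]) =
          y.map some ++ (Option.toList (some none) ++ z) → x = y := fun y hy ↦
        (map_some_append_none_inj (x := x.map some ++ [none]) (x' := z) (by simpa using hy)).1
      rcases hb with ⟨⟨y, hy, rfl⟩, -⟩ | ⟨r, hr⟩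
      · exact hy (hw' y hw ▸ hx)
      · obtain ⟨y, rfl, hy⟩ := (hE' r _ _).1 ⟨_, hr⟩
        exact hv r (hw' y hw ▸ hy)
  · intro h w
    by_cases hw : none ∈ w
    · obtain ⟨a, b, rfl, ha⟩ := List.eq_append_cons_of_mem hw
      obtain ⟨x, rfl⟩ := exists_eq_map_some ha
      by_cases hx : x ∈ L
      · obtain ⟨r, hr⟩ : ∃ r, simulate r x n = none := by
          by_contra! hr
          exact h ⟨x, hx, hr⟩
        obtain ⟨m, hm⟩ := (hE' r n _).2 ⟨x, rfl, hr⟩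
        exact ⟨m, .inr ⟨_, none :: (b ++ (x.map some ++ none :: b)), m, by simp, .inr ⟨r, hm⟩,
          [none], _, m, rfl, ⟨rfl, rfl⟩, trivial, rfl⟩⟩
      · exact ⟨n, .inr ⟨_, none :: (b ++ (x.map some ++ none :: b)), n, by simp,
          .inl ⟨⟨x, hx, rfl⟩, rfl⟩, [none], _, n, rfl, ⟨rfl, rfl⟩, trivial, rfl⟩⟩
    · exact ⟨n, .inl ⟨exists_eq_map_some (by simpa using hw), rfl⟩⟩

end Errors

/-! ### Undecidability. -/

theorem exists_not_computablePred_applicable : ∃ (k : ℕ) (L : Language (Fin k × CounterOp)),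
    L.IsRegular ∧ ¬ ComputablePred fun n : ℕ ↦ ∃ x ∈ L, ∀ r, simulate r x n ≠ none := by
  let f : ℕ →. ℕ := fun n ↦ (Denumerable.ofNat Nat.Partrec.Code n).eval 0
  have hf : Partrec f := Nat.Partrec.Code.eval_part.comp (Computable.ofNat _) (Computable.const 0)
  have hhalt : ¬ ComputablePred fun n : ℕ ↦ (f n).Dom := fun h ↦
    ComputablePred.halting_problem 0 <| ComputablePred.computable_of_manyOneReducible
      ⟨Encodable.encode, Computable.encode, fun c ↦ by simp [f]⟩ h
  -- The input is register 0 and the output register 1. As scratch registers may start with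
  -- anything, all registers may start with `n`, which leaves a single parameter.
  obtain ⟨R, ⟨L, hL, ⟨k, hk⟩, hR⟩, hsound, hex⟩ :=
    RegisterComputable.of_partrec (Nat.Partrec'.part_iff₁.2 hf) (fun _ ↦ 0) 1 fun _ ↦ one_pos
  refine ⟨k, {x | x.map (Prod.map Fin.val id) ∈ L}, hL.comap_map _, fun h ↦ hhalt ?_⟩
  refine h.of_eq fun n ↦ ?_
  have hdom : (f n).Dom ↔ ∃ v', R (fun _ ↦ n) v' :=
    ⟨fun hd ↦ hex (fun _ ↦ n) (by simpa using hd),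
      fun ⟨v', hv⟩ ↦ Part.dom_iff_mem.2 ⟨_, by simpa using (hsound _ _ hv).1⟩⟩
  rw [hdom]
  constructor
  · rintro ⟨x, hx, hv⟩
    have hv' : ∀ r : ℕ, ∃ m, simulate r (x.map (Prod.map Fin.val id)) n = some m := by
      intro r
      by_cases hr : r < k
      · rw [← Option.ne_none_iff_exists', ← Fin.val_mk hr, simulate_map Fin.val_injective]
        exact hv ⟨r, hr⟩
      -- Words of `L` do not touch the registers from `k` on, so these cannot fail.
      · refine ⟨n, simulate_of_notMem (fun a ha ↦ ?_) n⟩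
        have := hk _ hx a ha
        omega
    choose v' hv' using hv'
    exact ⟨v', (hR _ _).2 ⟨_, hx, hv'⟩⟩
  · rintro ⟨v', hv⟩
    obtain ⟨x, hx, hv⟩ := (hR _ _).1 hv
    obtain ⟨y, rfl⟩ : x ∈ Set.range (List.map (Prod.map (Fin.val : Fin k → ℕ) id)) := by
      rw [Set.range_list_map]
      exact fun a ha ↦ ⟨(⟨a.1, hk x hx a ha⟩, a.2), rfl⟩
    refine ⟨y, hx, fun r ↦ ?_⟩
    rw [← simulate_map Fin.val_injective, hv]
    exact Option.some_ne_none _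

theorem exists_alphabet_not_computablePred_squares : ∃ k : ℕ, ¬ ComputablePred fun c : CounterCode ↦
    copyLanguage (⊤ : Language (Fin k)) ≤ (c.toAutomaton k).language := by
  obtain ⟨k, L, hL, hnot⟩ := exists_not_computablePred_applicable
  obtain ⟨R, hR, hsq⟩ := exists_isCounterRel_squares_iff hL
  obtain ⟨K, ⟨e⟩⟩ := Finite.exists_equiv_fin (Option (Fin k × CounterOp))
  obtain ⟨c, hc, hlang⟩ := (hR.relabel e).exists_computable_code
  refine ⟨K, fun h ↦ hnot ?_⟩
  have hcomp := ComputablePred.computable_of_manyOneReducible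
    (p := fun n ↦ copyLanguage (⊤ : Language (Fin K)) ≤ ((c n).toAutomaton K).language)
    ⟨c, hc, fun _ ↦ Iff.rfl⟩ h
  refine hcomp.not.of_eq fun n ↦ ?_
  rw [not_iff_comm, ← hsq]
  constructor
  · intro hn w ⟨u, _, hw⟩
    refine (hlang n w).2 ?_
    rw [hw, List.map_append]
    exact hn _
  · intro hn w
    have := (hlang n _).1 (hn (show w.map e ++ w.map e ∈ copyLanguage ⊤ from ⟨_, trivial, rfl⟩))
    simpa using this

theorem theorem4p7 :
    -- Undecidability, with the alphabet as part of the input.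
    (¬ ComputablePred fun p : ℕ × CounterCode =>
      copyLanguage (⊤ : Language (Fin p.1)) ≤ (p.2.toAutomaton p.1).language) ∧
    -- Undecidability already over some fixed finite alphabet.
    (∃ k : ℕ, ¬ ComputablePred fun c : CounterCode =>
      copyLanguage (⊤ : Language (Fin k)) ≤ (c.toAutomaton k).language) ∧
    -- The language built from an instance of the Post correspondence problem.
    (∀ (σ δ : Type) [Finite σ] [Finite δ] (g h : FreeMonoid σ →* FreeMonoid δ),
      IsCounterLanguage (pcpLanguage g h) ∧
      (∀ w : List (Option σ), w ++ w ∈ pcpLanguage g h ↔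
        ¬ ∃ u : List σ, w ++ w = hashWord u u ∧
          g (FreeMonoid.ofList u) = h (FreeMonoid.ofList u)) ∧
      -- With the word `##` of the empty solution added, inclusion of all squares expresses
      -- that the instance has no nonempty solution.
      IsCounterLanguage (pcpLanguage g h + {hashWord [] []}) ∧
      (copyLanguage (⊤ : Language (Option σ)) ≤ pcpLanguage g h + {hashWord [] []} ↔
        ¬ ∃ u : FreeMonoid σ, u ≠ 1 ∧ g u = h u)) := by
  obtain ⟨k, hk⟩ := exists_alphabet_not_computablePred_squares
  refine ⟨fun h ↦ hk ?_, ⟨k, hk⟩, fun σ δ _ _ g h ↦ ⟨isCounterLanguage_pcpLanguage g h,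
    square_mem_pcpLanguage_iff g h, isCounterLanguage_pcpLanguage_add g h,
    squares_le_pcpLanguage_iff g h⟩⟩
  exact ComputablePred.computable_of_manyOneReducible
    ⟨fun c ↦ (k, c), (Computable.const k).pair Computable.id, fun _ ↦ Iff.rfl⟩ h
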